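/- \textbf{Setting.} Let $N$ be a lattice of rank $d$, $M=\mathrm{Hom}(N,\mathbb Z)$, and let $\Sigma$ be a complete simplicial fan in $N_{\mathbb R}$ with minimal integral ray generators $e_1,\dots,e_n$. For a finite collection of cones with generators $e_r$ $(r\in R)$, let $B=\langle\prod_{e_r\notin\sigma}x_r\rangle$ ($\sigma$ in the collection), let $G\subset(\mathbb C^*)^R$ be given by $\prod_r g_r^{\langle m,e_r\rangle}=1$ for all lattice covectors $m$, and let the associated toric variety be the quotient $(\mathbb C^R\setminus \mathbf V(B))/G$; its homogeneous coordinate ring $\mathbb C[x_r]$ is graded by the Chow group $\mathbb Z^R/M$. Write $\mathbf P_\Sigma$ for the toric variety of $\Sigma$. Assume that the anticanonical divisor $\sum_i D_i$, $D_i=\{x_i=0\}$, is semiample, that $\Delta=\{m\in M_{\mathbb R}:\langle m,e_i\rangle\ge-1\ \forall i\}$ is reflexive, that the $e_i$ lie on the boundary of the dual polytope $\Delta^\circ=\{v\in N_{\mathbb R}:\langle m,v\rangle\ge-1\ \forall m\in\Delta\}$, and that all lattice points of some edge $\Gamma^*$ of $\Delta^\circ$ are among the $e_i$. List these points in their order along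 $\Gamma^*$ as $e_{i_0},\dots,e_{i_{k+1}}$ $(k\ge0)$. \textbf{The new toric variety.} Let $v_1,\dots,v_k$ be the standard basis of $\mathbb Z^k$ and put $\delta=\frac1{k+1}(e_{i_{k+1}}-e_{i_0})\in N$. In $N\oplus\mathbb Z^k$ set $\tilde e_{s_j}=v_j$ $(1\le j\le k)$, $\tilde e_{s_{k+1}}=e_{i_0}-v_1-\cdots-v_k$, $\tilde e_{t_{j-1}}=\tilde e_{s_j}+\delta$ $(1\le j\le k+1)$, and $\tilde e_r=e_r$ for $e_r\notin\Gamma^*$. Let $\Sigma(\Gamma^*)$ consist of the following cones, one for each $\sigma\in\Sigma$, and of their faces. The cone is generated by all $e_r\in\sigma$ with $e_r\notin\Gamma^*$ and, in addition, (i) by nothing more if no $e_{i_l}$ lies in $\sigma$; (ii) by $\tilde e_{t_0},\dots,\tilde e_{t_{j-1}},\tilde e_{s_{j+1}},\dots,\tilde e_{s_{k+1}}$ if $e_{i_j}$ is the only $e_{i_l}$ in $\sigma$; (iii) by $\tilde e_{t_0},\dots,\tilde e_{t_j},\tilde e_{s_{j+1}},\dots,\tilde e_{s_{k+1}}$ if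 $e_{i_j},e_{i_{j+1}}$ are exactly the $e_{i_l}$ in $\sigma$. Let $\mathbf P_{\Sigma(\Gamma^*)}$ be the toric variety of $\Sigma(\Gamma^*)$ with these generators, with homogeneous coordinates $s_1,\dots,s_{k+1},t_0,\dots,t_k$ and $y_r$ for $e_r\notin\Gamma^*$. \textbf{Statement.} Let $X\subset\mathbf P_\Sigma$ be an anticanonical hypersurface $f=0$, $f=\sum_{m\in\Delta\cap M}a_m\prod_{i=1}^n x_i^{1+\langle m,e_i\rangle}$, that is nondegenerate: the polynomials $x_i\,\partial f/\partial x_i$, $1\le i\le n$, have no common zero on $\mathbf P_\Sigma$. Then the formulas $$s_j=x_{i_0}\cdots x_{i_{j-1}}\ (1\le j\le k+1),\qquad t_j=x_{i_{j+1}}\cdots x_{i_{k+1}}\ (0\le j\le k),\qquad y_r=x_r\ (e_r\notin\Gamma^*)$$ define an injective map $\mathbf P_\Sigma\to\mathbf P_{\Sigma(\Gamma^*)}$, the image of $X$ under it is the common zero locus of $$s_{j+1}t_j-s_jt_{j-1}\quad(1\le j\le k),\qquad \tilde f=\sum_{m\in\Delta\cap M}a_mX_m\prod_{e_r\notin\Gamma^*}y_r^{1+\langle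 m,e_r\rangle},$$ where $$X_m=\begin{cases}(s_1t_0)^{1+\langle m,e_{i_0}\rangle}(t_0\cdots t_k)^{\langle m,e_{i_1}-e_{i_0}\rangle}&\text{if }\langle m,e_{i_1}-e_{i_0}\rangle\ge0,\\(s_1t_0)^{1+\langle m,e_{i_{k+1}}\rangle}(s_1\cdots s_{k+1})^{\langle m,e_{i_0}-e_{i_1}\rangle}&\text{if }\langle m,e_{i_1}-e_{i_0}\rangle<0,\end{cases}$$ and this complete intersection is quasismooth in $\mathbf P_{\Sigma(\Gamma^*)}$: the $k+1$ polynomials are homogeneous for the Chow group grading, and at every point of $\mathbb C^{n+k}\setminus\mathbf V(B(\Sigma(\Gamma^*)))$ where they all vanish, their Jacobian matrix with respect to all the variables $s_j,t_j,y_r$ has the maximal rank $k+1$. -/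

import Mathlib

open MvPolynomial

noncomputable section

namespace ToricCI

/-! ### Fans

The lattice is `N = ι → ℤ` with `N_ℝ = ι → ℝ`; its dual lattice is `M = ι → ℤ` with
`M_ℝ = ι → ℝ`, and the pairing is the dot product. -/

section Fans

variable {ι : Type*} [Fintype ι]

/-- The inclusion of the lattice `ι → ℤ` into the real vector space `ι → ℝ`. -/
def toReal (v : ι → ℤ) : ι → ℝ := fun a => (v a : ℝ)

/-- A fan: a finite collection of strongly convex rational polyhedral cones which contains each
face of each of its cones, and in which any two cones meet along a face of each. -/
structure IsFan (S : Set (PointedCone ℝ (ι → ℝ))) : Prop where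
  finite : S.Finite
  rational : ∀ σ ∈ S, ∃ A : Set (ι → ℤ), A.Finite ∧ σ = PointedCone.hull ℝ (toReal '' A)
  stronglyConvex : ∀ σ ∈ S, ∀ x ∈ σ, -x ∈ σ → x = 0
  face_mem : ∀ σ ∈ S, ∀ τ : PointedCone ℝ (ι → ℝ), τ.IsFaceOf σ → τ ∈ S
  inter_face : ∀ σ ∈ S, ∀ τ ∈ S, (σ ⊓ τ).IsFaceOf σ ∧ (σ ⊓ τ).IsFaceOf τ

/-- A collection of cones is complete if it covers the whole space. -/
def IsComplete (S : Set (PointedCone ℝ (ι → ℝ))) : Prop :=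
  ∀ x : ι → ℝ, ∃ σ ∈ S, x ∈ σ

/-- All cones of the collection are simplicial. -/
def IsSimplicial (S : Set (PointedCone ℝ (ι → ℝ))) : Prop :=
  ∀ σ ∈ S, σ.IsSimplicial

/-- `ρ` is a one-dimensional cone of the collection. -/
def IsRay (S : Set (PointedCone ℝ (ι → ℝ))) (ρ : PointedCone ℝ (ι → ℝ)) : Prop :=
  ρ ∈ S ∧ Module.finrank ℝ (Submodule.span ℝ (ρ : Set (ι → ℝ))) = 1

/-- `v` is the minimal integral generator of the cone `ρ`: the lattice points of `ρ` are
exactly the natural multiples of `v`. -/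
def IsMinimalGenerator (v : ι → ℤ) (ρ : PointedCone ℝ (ι → ℝ)) : Prop :=
  ∀ w : ι → ℤ, toReal w ∈ ρ ↔ ∃ c : ℕ, w = c • v

/-- The family `e` lists, without repetition, the minimal integral generators of the
one-dimensional cones of the collection. -/
structure IsRayGenerators {R : Type*} (S : Set (PointedCone ℝ (ι → ℝ))) (e : R → ι → ℤ) :
    Prop where
  injective : Function.Injective e
  generates : ∀ r, ∃ ρ, IsRay S ρ ∧ IsMinimalGenerator (e r) ρ
  surjective : ∀ ρ, IsRay S ρ → ∃ r, IsMinimalGenerator (e r) ρ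

end Fans

/-! ### Toric varieties as quotients, and subvarieties in homogeneous coordinates -/

section Quotients

variable {ι : Type*} [Fintype ι] {R : Type*} [Fintype R]

/-- The complement in `ℂ^R` of the zero locus of the irrelevant ideal
`B = ⟨∏_{e_r ∉ σ} x_r : σ ∈ S⟩`. -/
def coxOpen (S : Set (PointedCone ℝ (ι → ℝ))) (e : R → ι → ℤ) : Set (R → ℂ) :=
  {x | ∃ σ ∈ S, ∀ r, toReal (e r) ∉ σ → x r ≠ 0}

/-- The subgroup of the torus `(ℂˣ)^R` given by `∏_r g_r ^ ⟨m, e_r⟩ = 1` for all `m ∈ M`. -/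
def coxGroup (e : R → ι → ℤ) : Subgroup (R → ℂˣ) where
  carrier := {g | ∀ m : ι → ℤ, ∏ r, g r ^ (m ⬝ᵥ e r) = 1}
  one_mem' := by intro m; simp
  mul_mem' := by
    intro g h hg hh m
    simp only [Pi.mul_apply, mul_zpow, Finset.prod_mul_distrib, hg m, hh m, mul_one]
  inv_mem' := by
    intro g hg m
    simp only [Pi.inv_apply, inv_zpow, Finset.prod_inv_distrib, hg m, inv_one]

/-- Two points of `coxOpen S e` are equivalent if they lie in one orbit of the diagonal action
of `coxGroup e`. -/
def coxSetoid (S : Set (PointedCone ℝ (ι → ℝ))) (e : R → ι → ℤ) : Setoid (coxOpen S e) where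
  r x y := ∃ g ∈ coxGroup e, ∀ r, y.1 r = (g r : ℂ) * x.1 r
  iseqv :=
    { refl := fun x => ⟨1, one_mem _, by simp⟩
      symm := by
        rintro x y ⟨g, hg, h⟩
        exact ⟨g⁻¹, inv_mem hg, fun r => by simp [h r]⟩
      trans := by
        rintro x y z ⟨g, hg, h⟩ ⟨g₂, hg₂, h₂⟩
        exact ⟨g₂ * g, mul_mem hg₂ hg, fun r => by simp [h r, h₂ r, mul_assoc]⟩ }

/-- The (points of the) toric variety of a simplicial fan `S` with ray generators `e`, as the
geometric quotient of `coxOpen S e` by `coxGroup e`. -/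
def ToricVariety (S : Set (PointedCone ℝ (ι → ℝ))) (e : R → ι → ℤ) : Type _ :=
  Quotient (coxSetoid S e)

/-- The point of the toric variety with given homogeneous coordinates. -/
def toricPoint (S : Set (PointedCone ℝ (ι → ℝ))) (e : R → ι → ℤ) (x : R → ℂ)
    (hx : x ∈ coxOpen S e) : ToricVariety S e :=
  Quotient.mk (coxSetoid S e) ⟨x, hx⟩

/-- The subset of the toric variety cut out by a family of (homogeneous) polynomials. -/
def zeroLocus (S : Set (PointedCone ℝ (ι → ℝ))) (e : R → ι → ℤ) {κ : Type*}
    (F : κ → MvPolynomial R ℂ) : Set (ToricVariety S e) :=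
  {P | ∃ (x : R → ℂ) (hx : x ∈ coxOpen S e),
    P = toricPoint S e x hx ∧ ∀ c, eval x (F c) = 0}

/-- The group `ℤ^R / M` of classes of torus-invariant Weil divisors, that is, the Chow group of
codimension one of the toric variety. -/
abbrev ClassGp (e : R → ι → ℤ) : Type _ :=
  (R → ℤ) ⧸ (LinearMap.range (LinearMap.pi fun r =>
    (dotProductBilin ℤ ℤ).flip (e r) : (ι → ℤ) →ₗ[ℤ] (R → ℤ)))

open Classical in
/-- The class of the prime divisor `x_r = 0`, which is the degree of the variable `x_r`. -/
def degVar (e : R → ι → ℤ) (r : R) : ClassGp e :=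
  Submodule.Quotient.mk (Pi.single r 1)

/-- Homogeneity in the homogeneous coordinate ring, graded by the Chow group. -/
def IsHomogeneousPoly (e : R → ι → ℤ) (F : MvPolynomial R ℂ) : Prop :=
  ∃ β : ClassGp e, IsWeightedHomogeneous (degVar e) F β

/-- The homogeneous polynomials `F c` define a quasismooth complete intersection: at each point
of their common zero locus the Jacobian matrix has maximal rank, the number of equations. -/
structure IsQuasismoothCI (S : Set (PointedCone ℝ (ι → ℝ))) (e : R → ι → ℤ) {κ : Type*}
    [Fintype κ] (F : κ → MvPolynomial R ℂ) : Prop where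
  homogeneous : ∀ c, IsHomogeneousPoly e (F c)
  jacobian : ∀ x ∈ coxOpen S e, (∀ c, eval x (F c) = 0) →
    (Matrix.of fun (c : κ) (r : R) => eval x (pderiv r (F c))).rank = Fintype.card κ

end Quotients

/-! ### The anticanonical polytope and anticanonical hypersurfaces -/

section Anticanonical

variable {ι : Type*} [Fintype ι] {R : Type*} [Fintype R]

/-- The polytope `Δ` of the anticanonical divisor: all `m` with `⟨m, e_r⟩ ≥ -1` for all `r`. -/
def antiPolytope (e : R → ι → ℤ) : Set (ι → ℝ) :=
  {m | ∀ r, -1 ≤ m ⬝ᵥ toReal (e r)}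

/-- The dual polytope `{v : ⟨m, v⟩ ≥ -1 for all m ∈ P}`. -/
def dualPolytope (P : Set (ι → ℝ)) : Set (ι → ℝ) :=
  {v | ∀ m ∈ P, -1 ≤ m ⬝ᵥ v}

/-- A polytope all of whose vertices are lattice points and whose only interior lattice point
is the origin. -/
def IsLatticePolytopeWithCenter (P : Set (ι → ℝ)) : Prop :=
  (∃ A : Set (ι → ℤ), A.Finite ∧ P = convexHull ℝ (toReal '' A)) ∧
    ∀ v : ι → ℤ, toReal v ∈ interior P ↔ v = 0

/-- Reflexive polytopes. -/
def IsReflexive (P : Set (ι → ℝ)) : Prop :=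
  IsLatticePolytopeWithCenter P ∧ IsLatticePolytopeWithCenter (dualPolytope P)

/-- The anticanonical divisor `D = ∑ D_r` is semiample: for some `q > 0` the linear system of
`q D`, which is spanned by the monomials `∏ x_r ^ (q + ⟨m, e_r⟩)` with all exponents
nonnegative, has no base points. -/
def IsSemiampleAnticanonical (S : Set (PointedCone ℝ (ι → ℝ))) (e : R → ι → ℤ) : Prop :=
  ∃ q : ℕ, 0 < q ∧ ∀ x ∈ coxOpen S e, ∃ m : ι → ℤ,
    (∀ r, 0 ≤ (q : ℤ) + m ⬝ᵥ e r) ∧ ∏ r, x r ^ ((q : ℤ) + m ⬝ᵥ e r).toNat ≠ 0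

/-- The polynomial `∑_m a_m ∏_r x_r ^ (1 + ⟨m, e_r⟩)`; the exponents are nonnegative as soon as
the (finite) support of `a` lies in `Δ ∩ M`. -/
def antiPoly (e : R → ι → ℤ) (a : (ι → ℤ) →₀ ℂ) : MvPolynomial R ℂ :=
  a.sum fun m c => C c * ∏ r, X r ^ (1 + m ⬝ᵥ e r).toNat

/-- The hypersurface `f = 0` is nondegenerate: the polynomials `x_r ∂f/∂x_r` do not vanish
simultaneously at any point of the toric variety. -/
def IsNondegenerate (S : Set (PointedCone ℝ (ι → ℝ))) (e : R → ι → ℤ)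
    (f : MvPolynomial R ℂ) : Prop :=
  ∀ x ∈ coxOpen S e, ∃ r, x r * eval x (pderiv r f) ≠ 0

end Anticanonical

/-! ### The construction associated with an edge -/

section Edge

variable {ι : Type*} [Fintype ι] {R : Type*} [Fintype R] {k : ℕ}

/-- An edge of a polytope: a one-dimensional face. -/
def IsEdge (P Γ : Set (ι → ℝ)) : Prop :=
  IsExposed ℝ P Γ ∧ Module.finrank ℝ (vectorSpan ℝ Γ) = 1

/-- The lattice points of `Γ` are precisely `e_{i_0}, …, e_{i_{k+1}}`, listed without repetition
and in the order in which they lie on `Γ`. -/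
structure ListsLatticePoints (Γ : Set (ι → ℝ)) (e : R → ι → ℤ) (i : Fin (k + 2) → R) :
    Prop where
  injective : Function.Injective i
  range_eq : ∀ v : ι → ℤ, toReal v ∈ Γ ↔ ∃ l, e (i l) = v
  ordered : ∀ a b c : Fin (k + 2), a ≤ b → b ≤ c →
    toReal (e (i b)) ∈ segment ℝ (toReal (e (i a))) (toReal (e (i c)))

/-- The index set of the variables `s_1, …, s_{k+1}`, `t_0, …, t_k` and `y_r` for `e_r ∉ Γ`. -/
abbrev EdgeVar (i : Fin (k + 2) → R) : Type _ :=
  Fin (k + 1) ⊕ Fin (k + 1) ⊕ {r : R // r ∉ Set.range i}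

/-- The index of `s_{j+1}`, for `0 ≤ j ≤ k`. -/
abbrev sIdx (i : Fin (k + 2) → R) (j : Fin (k + 1)) : EdgeVar i := Sum.inl j

/-- The index of `t_j`, for `0 ≤ j ≤ k`. -/
abbrev tIdx (i : Fin (k + 2) → R) (j : Fin (k + 1)) : EdgeVar i := Sum.inr (Sum.inl j)

/-- The index of `y_r`. -/
abbrev yIdx (i : Fin (k + 2) → R) (r : {r : R // r ∉ Set.range i}) : EdgeVar i :=
  Sum.inr (Sum.inr r)

/-- `(e_{i_{k+1}} - e_{i_0}) / (k + 1)`. The division is exact when the `e_{i_j}` are all the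
lattice points of an edge, since these are equally spaced. -/
def edgeStep (e : R → ι → ℤ) (i : Fin (k + 2) → R) : ι → ℤ :=
  fun a => (e (i (Fin.last (k + 1))) a - e (i 0) a) / ((k : ℤ) + 1)

/-- The lattice point of `s_{j+1}` in `N ⊕ ℤ^k`: it is `v_{j+1}` for `j < k`, and
`e_{i_0} - v_1 - ⋯ - v_k` for `j = k`. -/
def sGen (e : R → ι → ℤ) (i : Fin (k + 2) → R) (j : Fin (k + 1)) : ι ⊕ Fin k → ℤ :=
  if h : (j : ℕ) < k then Sum.elim 0 (Pi.single (⟨j, h⟩ : Fin k) 1)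
  else Sum.elim (e (i 0)) (fun _ => -1)

/-- The generators of the new fan: `s_{j+1}` corresponds to `sGen e i j`, `t_j` corresponds to
`sGen e i j + (e_{i_{k+1}} - e_{i_0}) / (k + 1)`, and `y_r` to `e_r`. -/
def edgeGen (e : R → ι → ℤ) (i : Fin (k + 2) → R) : EdgeVar i → (ι ⊕ Fin k → ℤ) :=
  Sum.elim (sGen e i)
    (Sum.elim (fun j => sGen e i j + Sum.elim (edgeStep e i) 0)
      (fun r => Sum.elim (e r.1) 0))

/-- `A` is the set of generators of the cone in `N_ℝ ⊕ ℝ^k` made from the cone `σ`, where the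
three cases are distinguished by which of the `e_{i_l}` are generators of `σ`: none of them, one
`e_{i_j}`, or two neighbours `e_{i_j}`, `e_{i_{j+1}}`. -/
def IsEdgeConeGens (e : R → ι → ℤ) (i : Fin (k + 2) → R) (σ : PointedCone ℝ (ι → ℝ))
    (A : Set (EdgeVar i)) : Prop :=
  ((∀ l, toReal (e (i l)) ∉ σ) ∧
    A = {p | ∃ r, p = yIdx i r ∧ toReal (e r.1) ∈ σ}) ∨
  (∃ j : Fin (k + 2), (∀ l, toReal (e (i l)) ∈ σ ↔ l = j) ∧
    A = {p | ∃ r, p = yIdx i r ∧ toReal (e r.1) ∈ σ} ∪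
      {p | ∃ c : Fin (k + 1), p = tIdx i c ∧ (c : ℕ) < j} ∪
      {p | ∃ c : Fin (k + 1), p = sIdx i c ∧ (j : ℕ) ≤ c}) ∨
  (∃ j : Fin (k + 1), (∀ l, toReal (e (i l)) ∈ σ ↔ l = j.castSucc ∨ l = j.succ) ∧
    A = {p | ∃ r, p = yIdx i r ∧ toReal (e r.1) ∈ σ} ∪
      {p | ∃ c : Fin (k + 1), p = tIdx i c ∧ (c : ℕ) ≤ j} ∪
      {p | ∃ c : Fin (k + 1), p = sIdx i c ∧ (j : ℕ) ≤ c})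

/-- The new fan in `N_ℝ ⊕ ℝ^k`: the cones spanned by the above sets of generators, with their
faces. -/
def edgeFan (S : Set (PointedCone ℝ (ι → ℝ))) (e : R → ι → ℤ) (i : Fin (k + 2) → R) :
    Set (PointedCone ℝ (ι ⊕ Fin k → ℝ)) :=
  {τ | ∃ σ ∈ S, ∃ A : Set (EdgeVar i), IsEdgeConeGens e i σ A ∧
    τ.IsFaceOf (PointedCone.hull ℝ ((fun p => toReal (edgeGen e i p)) '' A))}

/-- The map in homogeneous coordinates: `s_{j+1} = x_{i_0} ⋯ x_{i_j}`,
`t_j = x_{i_{j+1}} ⋯ x_{i_{k+1}}` and `y_r = x_r`. -/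
def edgeMap (i : Fin (k + 2) → R) (x : R → ℂ) : EdgeVar i → ℂ :=
  Sum.elim (fun j => ∏ l ∈ Finset.Iic j.castSucc, x (i l))
    (Sum.elim (fun j => ∏ l ∈ Finset.Ici j.succ, x (i l)) (fun r => x r.1))

/-- The equation `s_{j+1} t_j - s_j t_{j-1}` for `1 ≤ j ≤ k`, indexed by `j - 1`. -/
def binomialEq (i : Fin (k + 2) → R) (j : Fin k) : MvPolynomial (EdgeVar i) ℂ :=
  X (sIdx i j.succ) * X (tIdx i j.succ) - X (sIdx i j.castSucc) * X (tIdx i j.castSucc)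

/-- The monomial `X_m` in the variables `s` and `t`. The two expressions agree for
`⟨m, e_{i_1} - e_{i_0}⟩ = 0`. -/
def edgeMonomial (e : R → ι → ℤ) (i : Fin (k + 2) → R) (m : ι → ℤ) :
    MvPolynomial (EdgeVar i) ℂ :=
  if 0 ≤ m ⬝ᵥ (e (i 1) - e (i 0)) then
    (X (sIdx i 0) * X (tIdx i 0)) ^ (1 + m ⬝ᵥ e (i 0)).toNat *
      (∏ j, X (tIdx i j)) ^ (m ⬝ᵥ (e (i 1) - e (i 0))).toNat
  else
    (X (sIdx i 0) * X (tIdx i 0)) ^ (1 + m ⬝ᵥ e (i (Fin.last (k + 1)))).toNat *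
      (∏ j, X (sIdx i j)) ^ (m ⬝ᵥ (e (i 0) - e (i 1))).toNat

open Classical in
/-- The transformed polynomial `∑_m a_m X_m ∏_{e_r ∉ Γ} y_r ^ (1 + ⟨m, e_r⟩)`. -/
def edgePoly (e : R → ι → ℤ) (i : Fin (k + 2) → R) (a : (ι → ℤ) →₀ ℂ) :
    MvPolynomial (EdgeVar i) ℂ :=
  a.sum fun m c => C c * edgeMonomial e i m *
    ∏ r : {r : R // r ∉ Set.range i}, X (yIdx i r) ^ (1 + m ⬝ᵥ e r.1).toNat

/-- The `k + 1` equations of the complete intersection. -/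
def edgeEqs (e : R → ι → ℤ) (i : Fin (k + 2) → R) (a : (ι → ℤ) →₀ ℂ) :
    Fin k ⊕ Unit → MvPolynomial (EdgeVar i) ℂ :=
  Sum.elim (binomialEq i) (fun _ => edgePoly e i a)

end Edge

end ToricCI

end

/-!
The variables `s_{j+1}` and `t_j` are the complementary products `x_{i_0} ⋯ x_{i_j}` and
`x_{i_{j+1}} ⋯ x_{i_{k+1}}`, so the binomials `s_{j+1} t_j - s_j t_{j-1}` vanish on the image of
`edgeMap`. Conversely `x` is recovered from the `s` and `t` by dividing successive products,
provided that at most two neighbouring `x_{i_l}` vanish (`edgeMap_eq_of_edgeMap_eq`,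
`exists_edgeMap_eq`). This is where the fans come in. A cone `σ` of the given fan contains no two
of the `e_{i_l}` except neighbours, as the ray of a lattice point in between would meet `σ` in a
face containing both (`ListsLatticePoints.eq_add_one_of_mem`). The cone made from `σ` contains no
generators beyond the prescribed ones (`IsEdgeConeGens.mem_of_mem_hull`), so the coordinates that
must not vanish on the corresponding charts match under `edgeMap`, and its image in the new open
set is exactly the zero locus of the binomials (`exists_preimage_of_binomialEq`).

The lattice points of the edge are equally spaced (`ListsLatticePoints.eq_add_smul_edgeStep`). It
follows that `edgeMap` identifies the two groups (`mem_coxGroup_iff_edgeMap`,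
`exists_mem_coxGroup_edgeMap_eq`), so that it descends to an injective map of the quotients, and
that the transformed polynomial pulls back to the given one (`bind₁_edgePoly`).

For quasismoothness, let `x` be a point of the hypersurface and take a linear relation between the
gradients of the `k + 1` equations at `edgeMap i x`. Pulled back by the chain rule it says that the
gradient of the given polynomial at `x`, times the coefficient of the last equation, is zero; by
nondegeneracy that coefficient vanishes. The gradients of the binomials are independent since
`s_{j+1}` and `t_j` both vanish for at most one `j` (`eq_zero_of_sum_mul_pderiv_binomialEq`).
-/

noncomputable section

namespace ToricCI

/-! ### Lattice points of the edge -/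

section Geometry

variable {ι R : Type*} {k : ℕ}

theorem toReal_injective : Function.Injective (toReal : (ι → ℤ) → ι → ℝ) := by
  intro v w h
  funext a
  have := congrFun h a
  simpa [toReal] using this

theorem toReal_add (v w : ι → ℤ) : toReal (v + w) = toReal v + toReal w := by
  funext a; simp [toReal]

theorem toReal_sub (v w : ι → ℤ) : toReal (v - w) = toReal v - toReal w := by
  funext a; simp [toReal]

theorem convex_dualPolytope [Fintype ι] (P : Set (ι → ℝ)) : Convex ℝ (dualPolytope P) := by
  intro v hv w hw α β hα hβ hαβ m hm
  have h1 := mul_le_mul_of_nonneg_left (hv m hm) hα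
  have h2 := mul_le_mul_of_nonneg_left (hw m hm) hβ
  rw [dotProduct_add, dotProduct_smul, dotProduct_smul, smul_eq_mul, smul_eq_mul]
  linarith

/-- The lattice points of an edge are equally spaced: of two steps of different length, the shorter
one, starting where the longer one starts, would lead to a lattice point of the edge strictly
between two consecutive ones. In particular the integer division in `edgeStep` is exact. -/
theorem ListsLatticePoints.eq_add_smul_edgeStep {Γ : Set (ι → ℝ)} {e : R → ι → ℤ}
    {i : Fin (k + 2) → R} (hi : ListsLatticePoints Γ e i) (hΓ : Convex ℝ Γ)
    (he : Function.Injective e) (l : Fin (k + 2)) :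
    e (i l) = e (i 0) + (l : ℤ) • edgeStep e i := by
  have hinj : Function.Injective fun l => toReal (e (i l)) :=
    toReal_injective.comp (he.comp hi.injective)
  set V : ι → ℝ := toReal (e (i (Fin.last (k + 1)))) - toReal (e (i 0)) with hV
  have hV0 : V ≠ 0 := fun h => Fin.last_pos.ne' (hinj (sub_eq_zero.1 h))
  have hpar : ∀ l, ∃ τ : ℝ, 0 ≤ τ ∧ toReal (e (i l)) = toReal (e (i 0)) + τ • V := by
    intro l
    have := hi.ordered 0 l (Fin.last _) (Fin.zero_le _) (Fin.le_last _)
    rw [segment_eq_image'] at this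
    obtain ⟨θ, hθ, h⟩ := this
    exact ⟨θ, hθ.1, h.symm⟩
  choose τ hτ0 hτ using hpar
  have hcancel : ∀ {x y : ℝ}, toReal (e (i 0)) + x • V = toReal (e (i 0)) + y • V → x = y :=
    fun h => smul_left_injective ℝ hV0 (add_left_cancel h)
  have hmono : StrictMono τ := by
    intro a b hab
    refine lt_of_le_of_ne ?_ fun h => hab.ne (hinj ?_)
    · have := hi.ordered 0 a b (Fin.zero_le _) hab.le
      rw [segment_eq_image'] at this
      obtain ⟨θ, hθ, h⟩ := this
      have h2 : τ a = θ * τ b := by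
        apply hcancel
        rw [← hτ, ← h, hτ b]
        change _ + _ • (_ - _) = _
        rw [add_sub_cancel_left, smul_smul]
      rw [h2]
      exact mul_le_of_le_one_left (hτ0 b) hθ.2
    · change toReal (e (i a)) = toReal (e (i b))
      rw [hτ a, hτ b, h]
  have hfirst : τ 0 = 0 := hcancel (by rw [← hτ, zero_smul, add_zero])
  have hlast : τ (Fin.last _) = 1 := hcancel (by rw [← hτ, one_smul, hV, add_sub_cancel])
  -- A longer step could be cut by a translate of a shorter one, at a lattice point of the edge.
  have hstep : ∀ c c' : Fin (k + 1), τ c'.succ - τ c'.castSucc ≤ τ c.succ - τ c.castSucc := by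
    intro c c'
    by_contra! hlt
    have hpos : τ c.castSucc < τ c.succ := hmono Fin.castSucc_lt_succ
    have hv : toReal (e (i c'.castSucc) + (e (i c.succ) - e (i c.castSucc))) =
        toReal (e (i 0)) + (τ c'.castSucc + (τ c.succ - τ c.castSucc)) • V := by
      rw [toReal_add, toReal_sub, hτ c'.castSucc, hτ c.succ, hτ c.castSucc]
      module
    have hmem : toReal (e (i c'.castSucc) + (e (i c.succ) - e (i c.castSucc))) ∈ Γ := by
      apply hΓ.segment_subset ((hi.range_eq _).2 ⟨c'.castSucc, rfl⟩)
        ((hi.range_eq _).2 ⟨c'.succ, rfl⟩)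
      rw [segment_eq_image']
      have hpos' : 0 < τ c'.succ - τ c'.castSucc := by linarith
      refine ⟨(τ c.succ - τ c.castSucc) / (τ c'.succ - τ c'.castSucc),
        ⟨by apply div_nonneg <;> linarith, by rw [div_le_one hpos']; exact hlt.le⟩, ?_⟩
      change _ + _ • (_ - _) = _
      rw [hv, hτ c'.castSucc, hτ c'.succ, add_sub_add_left_eq_sub, ← sub_smul, smul_smul,
        div_mul_cancel₀ _ hpos'.ne']
      module
    obtain ⟨l, hl⟩ := (hi.range_eq _).1 hmem
    rw [← hl, hτ l] at hv
    have hl' := hcancel hv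
    have h1 : c'.castSucc < l := hmono.lt_iff_lt.1 (by linarith)
    have h2 : l < c'.succ := hmono.lt_iff_lt.1 (by linarith)
    rw [Fin.lt_def] at h1 h2
    simp at h1 h2
    omega
  have hlin : ∀ l : Fin (k + 2), τ l = (l : ℕ) * τ 1 := by
    intro l
    induction l using Fin.induction with
    | zero => simp [hfirst]
    | succ c ih =>
      have h := le_antisymm (hstep 0 c) (hstep c 0)
      simp only [Fin.succ_zero_eq_one, Fin.castSucc_zero, hfirst] at h
      rw [Fin.val_succ]
      rw [Fin.val_castSucc] at ih
      push_cast
      linarith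
  have hk : ((k : ℝ) + 1) * τ 1 = 1 := by
    have := hlin (Fin.last _)
    rw [hlast] at this
    simpa using this.symm
  have hE : ∀ (l : Fin (k + 2)) (a : ι),
      (e (i l) a : ℝ) = e (i 0) a + (l : ℕ) * τ 1 * V a := by
    intro l a
    have := congrFun (hτ l) a
    rw [hlin l] at this
    simpa [toReal] using this
  have hint : ∀ (l : Fin (k + 2)) (a : ι),
      e (i l) a = e (i 0) a + (l : ℕ) * (e (i 1) a - e (i 0) a) := by
    intro l a
    have h1 := hE 1 a
    have hl := hE l a
    have : (e (i l) a : ℝ) = e (i 0) a + (l : ℕ) * (e (i 1) a - e (i 0) a) := by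
      rw [h1, hl]; simp; ring
    exact_mod_cast this
  have hdelta : ∀ a, edgeStep e i a = e (i 1) a - e (i 0) a := by
    intro a
    have := hint (Fin.last _) a
    simp only [Fin.val_last] at this
    rw [edgeStep, this, add_sub_cancel_left]
    push_cast
    exact Int.mul_ediv_cancel_left _ (by positivity)
  funext a
  rw [hint l a, Pi.add_apply, Pi.smul_apply, hdelta, smul_eq_mul]

/-- A cone of the fan contains at most two of the `e_{i_l}`, and they are neighbours: the ray of
a lattice point in between would meet the cone in a face that contains both ends. -/
theorem ListsLatticePoints.eq_add_one_of_mem [Fintype ι] {S : Set (PointedCone ℝ (ι → ℝ))}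
    {Γ : Set (ι → ℝ)} {e : R → ι → ℤ} {i : Fin (k + 2) → R} (hS : IsFan S)
    (he : IsRayGenerators S e) (hne : ∀ r, e r ≠ 0) (hi : ListsLatticePoints Γ e i)
    {σ : PointedCone ℝ (ι → ℝ)} (hσ : σ ∈ S) {a b : Fin (k + 2)} (hab : a < b)
    (ha : toReal (e (i a)) ∈ σ) (hb : toReal (e (i b)) ∈ σ) : (b : ℕ) = a + 1 := by
  by_contra hcon
  have hlt : (a : ℕ) + 1 < b := by rw [Fin.lt_def] at hab; omega
  set c : Fin (k + 2) := ⟨a + 1, by omega⟩ with hc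
  have hac : a ≠ c := fun h => by simpa [hc] using congrArg Fin.val h
  have hcb : b ≠ c := fun h => hcon (by simpa [hc] using congrArg Fin.val h)
  obtain ⟨α, β, hα, hβ, hαβ, hcomb⟩ := hi.ordered a c b (by simp [Fin.le_def, hc])
    (by rw [Fin.le_def]; exact hlt.le)
  have hinj : Function.Injective fun l => toReal (e (i l)) :=
    toReal_injective.comp (he.injective.comp hi.injective)
  have hα' : 0 < α := by
    refine lt_of_le_of_ne hα fun h => hcb (hinj ?_)
    obtain rfl : β = 1 := by linarith
    simpa [← h] using hcomb
  have hβ' : 0 < β := by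
    refine lt_of_le_of_ne hβ fun h => hac (hinj ?_)
    obtain rfl : α = 1 := by linarith
    simpa [← h] using hcomb
  obtain ⟨ρ, hρ, hgen⟩ := he.generates (i c)
  have hcρ : toReal (e (i c)) ∈ ρ := (hgen _).2 ⟨1, by simp⟩
  have hface := (hS.inter_face σ hσ ρ hρ.1).1
  have hcσ : toReal (e (i c)) ∈ σ := by
    rw [← hcomb]
    exact add_mem (σ.smul_mem hα ha) (σ.smul_mem hβ hb)
  have hcm : toReal (e (i c)) ∈ σ ⊓ ρ := ⟨hcσ, hcρ⟩
  rw [← hcomb] at hcm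
  obtain ⟨p, hp⟩ := (hgen _).1 (hface.mem_of_smul_add_smul_mem_left ha hb hα' hβ' hcm).2
  obtain ⟨q, hq⟩ := (hgen _).1 (hface.mem_of_smul_add_smul_mem_right ha hb hα' hβ' hcm).2
  have two_le : ∀ {l : Fin (k + 2)} {p : ℕ}, l ≠ c → e (i l) = p • e (i c) → 2 ≤ p := by
    intro l p hl hp
    by_contra! hlt
    interval_cases p
    · exact hne _ (by simpa using hp)
    · exact hl (hi.injective (he.injective (by simpa using hp)))
  have hp2 : (2 : ℝ) ≤ p := by exact_mod_cast two_le hac hp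
  have hq2 : (2 : ℝ) ≤ q := by exact_mod_cast two_le hcb hq
  obtain ⟨x, hx⟩ : ∃ x, e (i c) x ≠ 0 := Function.ne_iff.1 (hne (i c))
  have hx' := congrFun hcomb x
  have hpx := congrFun hp x
  have hqx := congrFun hq x
  simp only [Pi.add_apply, Pi.smul_apply, toReal, hpx, hqx, smul_eq_mul, nsmul_eq_mul,
    Int.cast_mul, Int.cast_natCast] at hx'
  have : α * p + β * q = 1 := by
    have hxr : (e (i c) x : ℝ) ≠ 0 := by exact_mod_cast hx
    apply mul_right_cancel₀ hxr
    linarith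
  nlinarith

end Geometry

/-! ### Generators of the new cones -/

section EdgeCones

variable {ι R : Type*} {k : ℕ} {e : R → ι → ℤ} {i : Fin (k + 2) → R}
  {σ : PointedCone ℝ (ι → ℝ)} {A : Set (EdgeVar i)}

/-- The three cases in the construction of the new fan are exhaustive. -/
theorem exists_isEdgeConeGens
    (hσ : ∀ a b : Fin (k + 2), a < b → toReal (e (i a)) ∈ σ → toReal (e (i b)) ∈ σ →
      (b : ℕ) = a + 1) : ∃ A, IsEdgeConeGens e i σ A := by
  by_cases h0 : ∀ l, toReal (e (i l)) ∉ σ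
  · exact ⟨_, Or.inl ⟨h0, rfl⟩⟩
  push Not at h0
  obtain ⟨a, ha, hmin⟩ := WellFounded.has_min (wellFounded_lt (α := Fin (k + 2)))
    {l | toReal (e (i l)) ∈ σ} h0
  have hmin' : ∀ l, toReal (e (i l)) ∈ σ → a ≤ l := fun l hl => not_lt.1 (hmin l hl)
  by_cases h1 : ∀ l, toReal (e (i l)) ∈ σ → l = a
  · exact ⟨_, Or.inr (Or.inl ⟨a, fun l => ⟨h1 l, fun h => h ▸ ha⟩, rfl⟩)⟩
  push Not at h1
  obtain ⟨b, hb, hba⟩ := h1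
  have hab := hσ a b (lt_of_le_of_ne (hmin' b hb) hba.symm) ha hb
  have hblt := b.2
  obtain ⟨j, rfl⟩ : ∃ j : Fin (k + 1), j.castSucc = a := ⟨⟨a, by omega⟩, rfl⟩
  obtain rfl : j.succ = b := Fin.ext (by simpa using hab.symm)
  refine ⟨_, Or.inr (Or.inr ⟨j, fun l => ⟨fun hl => ?_, ?_⟩, rfl⟩)⟩
  · rcases (hmin' l hl).eq_or_lt with h | h
    · exact Or.inl h.symm
    · exact Or.inr (Fin.ext (by simpa using hσ _ _ h ha hl))
  · rintro (rfl | rfl)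
    exacts [ha, hb]

theorem IsEdgeConeGens.yIdx_mem_iff (hA : IsEdgeConeGens e i σ A)
    (r : {r : R // r ∉ Set.range i}) : yIdx i r ∈ A ↔ toReal (e r.1) ∈ σ := by
  rcases hA with ⟨-, rfl⟩ | ⟨j, -, rfl⟩ | ⟨j, -, rfl⟩ <;>
    simp only [Set.mem_union, Set.mem_ofPred_eq, reduceCtorEq, Sum.inr.injEq, false_and,
      exists_false, or_false, exists_eq_left']

/-- Together with `tIdx_mem_iff`, a description of the three cases by one formula: `s_{c+1}` is a
generator if some `e_{i_l}` with `l ≤ c` lies in `σ`, and `t_c` if some `e_{i_l}` with `l > c`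
does. -/
theorem IsEdgeConeGens.sIdx_mem_iff (hA : IsEdgeConeGens e i σ A) (c : Fin (k + 1)) :
    sIdx i c ∈ A ↔ ∃ l ≤ c.castSucc, toReal (e (i l)) ∈ σ := by
  rcases hA with ⟨h, rfl⟩ | ⟨j, h, rfl⟩ | ⟨j, h, rfl⟩
  · simp [sIdx, yIdx, h]
  · simp [sIdx, yIdx, tIdx, h, Fin.le_def]
  · simp only [Set.mem_union, Set.mem_ofPred_eq, reduceCtorEq, Sum.inl.injEq,
      false_and, exists_false, false_or, or_false, exists_eq_left', h]
    constructor
    · exact fun hj => ⟨j.castSucc, hj, Or.inl rfl⟩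
    · rintro ⟨l, hl, rfl | rfl⟩ <;> rw [Fin.le_def] at hl <;> simp at hl <;> omega

theorem IsEdgeConeGens.tIdx_mem_iff (hA : IsEdgeConeGens e i σ A) (c : Fin (k + 1)) :
    tIdx i c ∈ A ↔ ∃ l ≥ c.succ, toReal (e (i l)) ∈ σ := by
  rcases hA with ⟨h, rfl⟩ | ⟨j, h, rfl⟩ | ⟨j, h, rfl⟩
  · simp [tIdx, yIdx, h]
  · simp [sIdx, yIdx, tIdx, h, Fin.le_def]
  · simp only [Set.mem_union, Set.mem_ofPred_eq, reduceCtorEq, Sum.inl.injEq, Sum.inr.injEq,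
      false_and, exists_false, false_or, or_false, exists_eq_left', h]
    constructor
    · exact fun hj => ⟨j.succ, Nat.succ_le_succ hj, Or.inr rfl⟩
    · rintro ⟨l, hl, rfl | rfl⟩ <;> rw [ge_iff_le, Fin.le_def] at hl <;> simp at hl <;> omega

/-- The `e_{i_l}` in `σ` lie among two neighbours. -/
theorem IsEdgeConeGens.exists_split (hA : IsEdgeConeGens e i σ A) :
    ∃ J : Fin (k + 1), ∀ l, toReal (e (i l)) ∈ σ → l = J.castSucc ∨ l = J.succ := by
  rcases hA with ⟨h, -⟩ | ⟨j, h, -⟩ | ⟨j, h, -⟩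
  · exact ⟨0, fun l hl => absurd hl (h l)⟩
  · rcases Fin.eq_castSucc_or_eq_last j with ⟨j, rfl⟩ | rfl
    · exact ⟨j, fun l hl => Or.inl ((h l).1 hl)⟩
    · exact ⟨Fin.last k, fun l hl => Or.inr ((h l).1 hl)⟩
  · exact ⟨j, fun l => (h l).1⟩

/-- If `e_{i_l}` is not in `σ`, the shortest product `s` or the shortest product `t` containing
`x_{i_l}` belongs to a generator outside the new cone. -/
theorem IsEdgeConeGens.sIdx_or_tIdx_notMem (hA : IsEdgeConeGens e i σ A) {l : Fin (k + 2)}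
    (hl : toReal (e (i l)) ∉ σ) :
    (∃ c : Fin (k + 1), l = c.castSucc ∧ sIdx i c ∉ A) ∨
      ∃ c : Fin (k + 1), l = c.succ ∧ tIdx i c ∉ A := by
  by_cases hlow : ∃ a ≤ l, toReal (e (i a)) ∈ σ
  · right
    obtain ⟨a, hal, ha⟩ := hlow
    have hne : a ≠ l := fun h => hl (h ▸ ha)
    have hal' : (a : ℕ) < l := lt_of_le_of_ne hal fun h => hne (Fin.ext h)
    obtain ⟨c, rfl⟩ := Fin.exists_succ_eq.2
      (Fin.pos_iff_ne_zero.1 (lt_of_le_of_lt (Fin.zero_le _) hal'))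
    refine ⟨c, rfl, fun hc => ?_⟩
    obtain ⟨b, hcb, hb⟩ := (hA.tIdx_mem_iff c).1 hc
    have hne' : b ≠ c.succ := fun h => hl (h ▸ hb)
    have hcb' : (c.succ : ℕ) < b := lt_of_le_of_ne hcb fun h => hne' (Fin.ext h.symm)
    obtain ⟨J, hJ⟩ := hA.exists_split
    rcases hJ a ha with rfl | rfl <;> rcases hJ b hb with rfl | rfl <;> simp at hal' hcb' <;> omega
  · rcases Fin.eq_castSucc_or_eq_last l with ⟨c, rfl⟩ | rfl
    · exact Or.inl ⟨c, rfl, fun hc => hlow ((hA.sIdx_mem_iff c).1 hc)⟩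
    · refine Or.inr ⟨Fin.last k, Fin.succ_last k |>.symm, fun hc => ?_⟩
      obtain ⟨b, -, hb⟩ := (hA.tIdx_mem_iff _).1 hc
      exact hlow ⟨b, Fin.le_last b, hb⟩

end EdgeCones

/-! ### The generators contained in a new cone -/

section Projection

variable {ι R : Type*} {k : ℕ}

/-- The image of the generator of `s_{c+1}` under `edgeProj e i J`. -/
def edgeProjCol (e : R → ι → ℤ) (i : Fin (k + 2) → R) (J c : Fin (k + 1)) : ι → ℝ :=
  if c < J then -toReal (edgeStep e i)
  else if c = J then toReal (e (i J.castSucc)) else 0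

/-- A linear map `N_ℝ ⊕ ℝ^k → N_ℝ` which restricts to the identity on `N_ℝ`. Its values on the
vectors of the standard basis of `ℝ^k` are chosen so that, if `e_{i_0}, …, e_{i_{k+1}}` are equally
spaced, the generators of `s_{J+1}` and `t_J` go to `e_{i_J}` and `e_{i_{J+1}}`, those of `t_c` for
`c < J` and of `s_{c+1}` for `c > J` go to `0`, and the remaining ones to plus or minus the step
between the lattice points of the edge. -/
def edgeProj (e : R → ι → ℤ) (i : Fin (k + 2) → R) (J : Fin (k + 1)) :
    (ι ⊕ Fin k → ℝ) →ₗ[ℝ] (ι → ℝ) :=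
  LinearMap.funLeft ℝ ℝ Sum.inl +
    ∑ c : Fin k, (LinearMap.proj (Sum.inr c)).smulRight (edgeProjCol e i J c.castSucc)

theorem edgeProj_apply (e : R → ι → ℤ) (i : Fin (k + 2) → R) (J : Fin (k + 1))
    (w : ι ⊕ Fin k → ℝ) :
    edgeProj e i J w = (fun a => w (Sum.inl a)) +
      ∑ c : Fin k, w (Sum.inr c) • edgeProjCol e i J c.castSucc := by
  simp only [edgeProj, LinearMap.add_apply, LinearMap.sum_apply, LinearMap.smulRight_apply,
    LinearMap.proj_apply]
  rfl

theorem edgeProj_toReal_inl (e : R → ι → ℤ) (i : Fin (k + 2) → R) (J : Fin (k + 1))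
    (v : ι → ℤ) : edgeProj e i J (toReal (Sum.elim v 0)) = toReal v := by
  rw [edgeProj_apply]
  funext a
  simp [toReal]

theorem sum_edgeProjCol {e : R → ι → ℤ} {i : Fin (k + 2) → R}
    (hsp : ∀ l, e (i l) = e (i 0) + (l : ℤ) • edgeStep e i) (J : Fin (k + 1)) :
    ∑ c, edgeProjCol e i J c = toReal (e (i 0)) := by
  have h : ∀ c, edgeProjCol e i J c = (if c < J then -toReal (edgeStep e i) else 0) +
      if c = J then toReal (e (i J.castSucc)) else 0 := by
    intro c
    unfold edgeProjCol
    split_ifs with h1 h2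
    · exact absurd h2 h1.ne
    all_goals simp
  simp only [h, Finset.sum_add_distrib, Finset.sum_ite_eq', Finset.mem_univ, if_true]
  rw [← Finset.sum_filter, Finset.sum_const, hsp J.castSucc, Finset.filter_gt_eq_Iio, Fin.card_Iio]
  funext a
  simp [toReal]

theorem edgeProj_sGen {e : R → ι → ℤ} {i : Fin (k + 2) → R}
    (hsp : ∀ l, e (i l) = e (i 0) + (l : ℤ) • edgeStep e i) (J c : Fin (k + 1)) :
    edgeProj e i J (toReal (sGen e i c)) = edgeProjCol e i J c := by
  rw [edgeProj_apply]
  rcases Fin.eq_castSucc_or_eq_last c with ⟨c, rfl⟩ | rfl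
  · have h : sGen e i c.castSucc = Sum.elim (0 : ι → ℤ) (Pi.single c 1) := by
      simp [sGen]
    rw [h]
    funext a
    simp [toReal, Pi.single_apply]
  · have h : sGen e i (Fin.last k) = Sum.elim (e (i 0)) fun _ => -1 := by
      simp [sGen]
    have hsum := sum_edgeProjCol hsp J
    rw [Fin.sum_univ_castSucc] at hsum
    rw [h, ← sub_eq_iff_eq_add'.2 hsum.symm]
    funext a
    simp [toReal, sub_eq_add_neg]

theorem edgeProj_tGen {e : R → ι → ℤ} {i : Fin (k + 2) → R}
    (hsp : ∀ l, e (i l) = e (i 0) + (l : ℤ) • edgeStep e i) (J c : Fin (k + 1)) :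
    edgeProj e i J (toReal (edgeGen e i (tIdx i c))) =
      edgeProjCol e i J c + toReal (edgeStep e i) := by
  change edgeProj e i J (toReal (sGen e i c + _)) = _
  rw [toReal_add, map_add, edgeProj_sGen hsp, edgeProj_toReal_inl]

variable {e : R → ι → ℤ} {i : Fin (k + 2) → R} {σ : PointedCone ℝ (ι → ℝ)} {A : Set (EdgeVar i)}

/-- The only generators of the new fan in the cone spanned by `A` are those in `A`. For suitable `J`
the map `edgeProj e i J` sends the cone into `σ`. The image of a generator `p` in the cone is then
zero, or some `e_r ∈ σ`, or plus or minus the step along the edge, which puts `e_{i_{k+1}}` or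
`e_{i_0}` into `σ`; in each case the description of `A` in terms of `σ` gives `p ∈ A`. -/
theorem IsEdgeConeGens.mem_of_mem_hull
    (hsp : ∀ l, e (i l) = e (i 0) + (l : ℤ) • edgeStep e i) (hA : IsEdgeConeGens e i σ A)
    {p : EdgeVar i}
    (hp : toReal (edgeGen e i p) ∈ PointedCone.hull ℝ ((fun p => toReal (edgeGen e i p)) '' A)) :
    p ∈ A := by
  have hproj : ∀ J : Fin (k + 1), (∀ q ∈ A, edgeProj e i J (toReal (edgeGen e i q)) ∈ σ) →
      edgeProj e i J (toReal (edgeGen e i p)) ∈ σ := by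
    intro J h
    have hle : PointedCone.hull ℝ ((fun p => toReal (edgeGen e i p)) '' A) ≤
        PointedCone.comap (edgeProj e i J) σ := by
      refine Submodule.span_le.2 ?_
      rintro _ ⟨q, hq, rfl⟩
      exact h q hq
    exact hle hp
  have hy : ∀ J (r : {r : R // r ∉ Set.range i}),
      edgeProj e i J (toReal (edgeGen e i (yIdx i r))) = toReal (e r.1) :=
    fun J r => edgeProj_toReal_inl e i J _
  have hs : ∀ J c, edgeProj e i J (toReal (edgeGen e i (sIdx i c))) = edgeProjCol e i J c :=
    edgeProj_sGen hsp
  have ht := fun J c => edgeProj_tGen hsp J c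
  have hstep : ∀ {l : Fin (k + 2)} {c : ℕ} (l' : Fin (k + 2)), toReal (e (i l)) ∈ σ →
      (l' : ℕ) = l + c → toReal (edgeStep e i) ∈ σ → toReal (e (i l')) ∈ σ := by
    intro l c l' hl hl' hδ
    have : toReal (e (i l')) = toReal (e (i l)) + (c : ℝ) • toReal (edgeStep e i) := by
      rw [hsp l', hsp l, hl']
      funext a
      simp [toReal]
      ring
    rw [this]
    exact add_mem hl (σ.smul_mem c.cast_nonneg hδ)
  have hstep' : ∀ {l : Fin (k + 2)} {c : ℕ} (l' : Fin (k + 2)), toReal (e (i l)) ∈ σ →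
      (l' : ℕ) + c = l → -toReal (edgeStep e i) ∈ σ → toReal (e (i l')) ∈ σ := by
    intro l c l' hl hl' hδ
    have : toReal (e (i l')) = toReal (e (i l)) + (c : ℝ) • -toReal (edgeStep e i) := by
      rw [hsp l', hsp l, ← hl']
      funext a
      simp [toReal]
      ring
    rw [this]
    exact add_mem hl (σ.smul_mem c.cast_nonneg hδ)
  have hsucc : ∀ J : Fin (k + 1),
      toReal (e (i J.castSucc)) + toReal (edgeStep e i) = toReal (e (i J.succ)) := by
    intro J
    rw [hsp J.castSucc, hsp J.succ]
    funext a
    simp [toReal]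
    ring
  -- If `σ` contains some `e_{i_l}`, the index `J` depends only on `σ`; otherwise it is
  -- adapted to the generator `p`.
  by_cases hL : ∃ l, toReal (e (i l)) ∈ σ
  · obtain ⟨l₀, hl₀⟩ := hL
    obtain ⟨J, hJ⟩ := hA.exists_split
    have hmem : edgeProj e i J (toReal (edgeGen e i p)) ∈ σ := by
      refine hproj J ?_
      rintro (c | c | r) hq
      · obtain ⟨l, hlc, hl⟩ := (hA.sIdx_mem_iff c).1 hq
        rw [hs, edgeProjCol]
        split_ifs with h1 h2
        · exfalso
          rcases hJ l hl with rfl | rfl <;> rw [Fin.le_def] at hlc <;> rw [Fin.lt_def] at h1 <;>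
            simp at hlc <;> omega
        · subst h2
          rcases hJ l hl with rfl | rfl
          · exact hl
          · simp [Fin.le_def] at hlc
        · exact zero_mem _
      · obtain ⟨l, hlc, hl⟩ := (hA.tIdx_mem_iff c).1 hq
        rw [ht, edgeProjCol]
        split_ifs with h1 h2
        · rw [neg_add_cancel]; exact zero_mem _
        · subst h2
          rw [hsucc]
          rcases hJ l hl with rfl | rfl
          · simp [Fin.le_def] at hlc
          · exact hl
        · exfalso
          have h3 : (c : ℕ) ≠ J := fun h => h2 (Fin.ext h)
          rcases hJ l hl with rfl | rfl <;> rw [ge_iff_le, Fin.le_def] at hlc <;>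
            rw [Fin.lt_def] at h1 <;> simp at hlc <;> omega
      · exact (hy J r).symm ▸ (hA.yIdx_mem_iff r).1 hq
    rcases p with c | c | r
    · refine (hA.sIdx_mem_iff c).2 ?_
      rw [hs, edgeProjCol] at hmem
      split_ifs at hmem with h1 h2
      · exact ⟨0, Fin.zero_le _, hstep' (c := l₀) 0 hl₀ (by simp) hmem⟩
      · exact ⟨J.castSucc, by rw [h2], hmem⟩
      · refine ⟨l₀, ?_, hl₀⟩
        have h3 : (c : ℕ) ≠ J := fun h => h2 (Fin.ext h)
        rcases hJ l₀ hl₀ with rfl | rfl <;> rw [Fin.le_def] <;>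
            rw [Fin.lt_def] at h1 <;> simp <;> omega
    · refine (hA.tIdx_mem_iff c).2 ?_
      rw [ht, edgeProjCol] at hmem
      split_ifs at hmem with h1 h2
      · refine ⟨l₀, ?_, hl₀⟩
        rcases hJ l₀ hl₀ with rfl | rfl <;> rw [ge_iff_le, Fin.le_def] <;>
            rw [Fin.lt_def] at h1 <;> simp <;> omega
      · exact ⟨J.succ, by rw [h2], hsucc J ▸ hmem⟩
      · rw [zero_add] at hmem
        have := l₀.2
        exact ⟨Fin.last _, Fin.le_last _, hstep (c := k + 1 - l₀) _ hl₀ (by simp; omega) hmem⟩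
    · exact (hA.yIdx_mem_iff r).2 (hy J r ▸ hmem)
  · push Not at hL
    have hmem : ∀ J, edgeProj e i J (toReal (edgeGen e i p)) ∈ σ := by
      refine fun J => hproj J ?_
      rintro (c | c | r) hq
      · obtain ⟨l, -, hl⟩ := (hA.sIdx_mem_iff c).1 hq
        exact absurd hl (hL l)
      · obtain ⟨l, -, hl⟩ := (hA.tIdx_mem_iff c).1 hq
        exact absurd hl (hL l)
      · exact (hy J r).symm ▸ (hA.yIdx_mem_iff r).1 hq
    rcases p with c | c | r
    · have := hmem c
      rw [hs, edgeProjCol, if_neg (lt_irrefl c), if_pos rfl] at this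
      exact absurd this (hL _)
    · have := hmem c
      rw [ht, edgeProjCol, if_neg (lt_irrefl c), if_pos rfl, hsucc] at this
      exact absurd this (hL _)
    · exact (hA.yIdx_mem_iff r).2 (hy 0 r ▸ hmem 0)

end Projection

/-! ### Products of initial and final segments -/

section Products

variable {M : Type*} [CommMonoid M] {k : ℕ}

theorem prod_Iic_mul_prod_Ici (f : Fin (k + 2) → M) (c : Fin (k + 1)) :
    (∏ l ∈ Finset.Iic c.castSucc, f l) * ∏ l ∈ Finset.Ici c.succ, f l = ∏ l, f l := by
  rw [← Finset.prod_union]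
  · congr 1
    ext l
    simp only [Finset.mem_union, Finset.mem_Iic, Finset.mem_Ici, Fin.le_def, Fin.val_castSucc,
      Fin.val_succ, Finset.mem_univ, iff_true]
    omega
  · rw [Finset.disjoint_left]
    intro l
    simp [Fin.le_def]

theorem prod_prod_Ici (f : Fin (k + 2) → M) :
    ∏ c : Fin (k + 1), ∏ l ∈ Finset.Ici c.succ, f l = ∏ l, f l ^ (l : ℕ) := by
  rw [Finset.prod_comm' (t' := Finset.univ)
    (s' := fun l : Fin (k + 2) => {c : Fin (k + 1) | (c : ℕ) < l})]
  · refine Finset.prod_congr rfl fun l _ => ?_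
    have := l.2
    rw [Finset.prod_const, Fin.card_filter_val_lt, min_eq_right (by omega)]
  · intro c l
    simp [Fin.le_def]

theorem prod_prod_Iic (f : Fin (k + 2) → M) :
    ∏ c : Fin (k + 1), ∏ l ∈ Finset.Iic c.castSucc, f l = ∏ l, f l ^ (k + 1 - l : ℕ) := by
  rw [Finset.prod_comm' (t' := Finset.univ)
    (s' := fun l : Fin (k + 2) => {c : Fin (k + 1) | (l : ℕ) ≤ c})]
  · refine Finset.prod_congr rfl fun l _ => ?_
    have hl := l.2
    have hcard := Finset.card_filter_add_card_filter_not (s := Finset.univ)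
      fun c : Fin (k + 1) => (c : ℕ) < l
    rw [Fin.card_filter_val_lt, min_eq_right (by omega), Finset.card_univ,
      Fintype.card_fin] at hcard
    simp only [not_lt] at hcard
    rw [Finset.prod_const, ← hcard, Nat.add_sub_cancel_left]
    congr!
  · intro c l
    simp [Fin.le_def]

end Products

/-! ### The map in homogeneous coordinates -/

section EdgeMap

variable {R : Type*} {k : ℕ} {i : Fin (k + 2) → R}

theorem edgeMap_sIdx (x : R → ℂ) (c : Fin (k + 1)) :
    edgeMap i x (sIdx i c) = ∏ l ∈ Finset.Iic c.castSucc, x (i l) := rfl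

theorem edgeMap_tIdx (x : R → ℂ) (c : Fin (k + 1)) :
    edgeMap i x (tIdx i c) = ∏ l ∈ Finset.Ici c.succ, x (i l) := rfl

theorem edgeMap_yIdx (x : R → ℂ) (r : {r : R // r ∉ Set.range i}) :
    edgeMap i x (yIdx i r) = x r.1 := rfl

theorem edgeMap_sIdx_ne_zero_iff {x : R → ℂ} {c : Fin (k + 1)} :
    edgeMap i x (sIdx i c) ≠ 0 ↔ ∀ l ≤ c.castSucc, x (i l) ≠ 0 := by
  simp only [edgeMap_sIdx, Finset.prod_ne_zero_iff, Finset.mem_Iic]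

theorem edgeMap_tIdx_ne_zero_iff {x : R → ℂ} {c : Fin (k + 1)} :
    edgeMap i x (tIdx i c) ≠ 0 ↔ ∀ l ≥ c.succ, x (i l) ≠ 0 := by
  simp only [edgeMap_tIdx, Finset.prod_ne_zero_iff, Finset.mem_Ici, ge_iff_le]

theorem edgeMap_mul (x y : R → ℂ) : edgeMap i (x * y) = edgeMap i x * edgeMap i y := by
  funext p
  rcases p with c | c | r
  · exact Finset.prod_mul_distrib (s := Finset.Iic c.castSucc) (f := fun l => x (i l))
      (g := fun l => y (i l))
  · exact Finset.prod_mul_distrib (s := Finset.Ici c.succ) (f := fun l => x (i l))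
      (g := fun l => y (i l))
  · rfl

theorem edgeMap_sIdx_mul_tIdx (x : R → ℂ) (c : Fin (k + 1)) :
    edgeMap i x (sIdx i c) * edgeMap i x (tIdx i c) = ∏ l, x (i l) :=
  prod_Iic_mul_prod_Ici (fun l => x (i l)) c

/-- If at most the neighbours `x_{i_J}` and `x_{i_{J+1}}` vanish, `x` can be recovered from its
image: the `x_{i_l}` with `l ≤ J` by dividing successive `s`, those with `l > J` by dividing
successive `t`. -/
theorem edgeMap_eq_of_edgeMap_eq {x y : R → ℂ} (J : Fin (k + 1))
    (hx : ∀ l, x (i l) = 0 → l = J.castSucc ∨ l = J.succ) (h : edgeMap i x = edgeMap i y) :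
    x = y := by
  have hlow : ∀ l : Fin (k + 2), l ≤ J.castSucc → x (i l) = y (i l) := by
    intro l
    induction l using WellFoundedLT.induction with
    | ind l ih =>
      intro hl
      obtain ⟨c, rfl⟩ : ∃ c : Fin (k + 1), c.castSucc = l :=
        ⟨⟨l, by have := J.2; rw [Fin.le_def] at hl; simp at hl; omega⟩, rfl⟩
      have hc := congrFun h (sIdx i c)
      rw [edgeMap_sIdx, edgeMap_sIdx, ← Finset.Iio_insert,
        Finset.prod_insert Finset.notMem_Iio_self, Finset.prod_insert Finset.notMem_Iio_self,
        ← Finset.prod_congr rfl fun b hb =>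
          ih b (Finset.mem_Iio.1 hb) ((Finset.mem_Iio.1 hb).le.trans hl)] at hc
      refine mul_right_cancel₀ (Finset.prod_ne_zero_iff.2 fun b hb h0 => ?_) hc
      have hb' := (Finset.mem_Iio.1 hb).trans_le hl
      rcases hx b h0 with rfl | rfl
      · exact lt_irrefl _ hb'
      · exact absurd hb' (Fin.castSucc_lt_succ).not_gt
  have hhigh : ∀ l : Fin (k + 2), J.succ ≤ l → x (i l) = y (i l) := by
    intro l
    induction l using WellFoundedGT.induction with
    | ind l ih =>
      intro hl
      obtain ⟨c, rfl⟩ := Fin.exists_succ_eq.2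
        (Fin.pos_iff_ne_zero.1 ((Fin.succ_pos J).trans_le hl))
      have hc := congrFun h (tIdx i c)
      rw [edgeMap_tIdx, edgeMap_tIdx, ← Finset.Ioi_insert,
        Finset.prod_insert Finset.notMem_Ioi_self, Finset.prod_insert Finset.notMem_Ioi_self,
        ← Finset.prod_congr rfl fun b hb =>
          ih b (Finset.mem_Ioi.1 hb) (hl.trans (Finset.mem_Ioi.1 hb).le)] at hc
      refine mul_right_cancel₀ (Finset.prod_ne_zero_iff.2 fun b hb h0 => ?_) hc
      have hb' := hl.trans_lt (Finset.mem_Ioi.1 hb)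
      rcases hx b h0 with rfl | rfl
      · exact absurd hb' (Fin.castSucc_lt_succ).not_gt
      · exact lt_irrefl _ hb'
  funext r
  by_cases hr : r ∈ Set.range i
  · obtain ⟨l, rfl⟩ := hr
    rcases le_or_gt l J.castSucc with hl | hl
    · exact hlow l hl
    · exact hhigh l (by rw [Fin.lt_def] at hl; rw [Fin.le_def]; simpa using hl)
  · exact congrFun h (yIdx i ⟨r, hr⟩)

/-- A point at which all `s_{c+1} t_c` agree is in the image of `edgeMap` as soon as `s_{c+1} ≠ 0`
for `c < J` and `t_c ≠ 0` for `c > J`. -/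
theorem exists_edgeMap_eq (hi : Function.Injective i) {z : EdgeVar i → ℂ} (J : Fin (k + 1))
    (hs : ∀ c < J, z (sIdx i c) ≠ 0) (ht : ∀ c > J, z (tIdx i c) ≠ 0)
    (hst : ∀ c, z (sIdx i c) * z (tIdx i c) = z (sIdx i J) * z (tIdx i J)) :
    ∃ x, edgeMap i x = z := by
  -- `s n` and `t n` are the prescribed products over `l < n` and over `l ≥ n`, with value `1` for
  -- the empty products `s 0` and `t (k + 2)`; the value `t 0` is not used.
  let s : ℕ → ℂ := fun n => if h : n - 1 < k + 1 ∧ n ≠ 0 then z (sIdx i ⟨n - 1, h.1⟩) else 1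
  let t : ℕ → ℂ := fun n => if h : n - 1 < k + 1 then z (tIdx i ⟨n - 1, h⟩) else 1
  let u : ℕ → ℂ := fun n => if n ≤ J then s (n + 1) / s n else t n / t (n + 1)
  have hs1 : ∀ c : Fin (k + 1), s (c + 1) = z (sIdx i c) := fun c => by
    simp only [s, Nat.add_sub_cancel, dif_pos (And.intro c.2 (Nat.succ_ne_zero c))]
  have ht1 : ∀ c : Fin (k + 1), t (c + 1) = z (tIdx i c) := fun c => by
    simp only [t, Nat.add_sub_cancel, dif_pos c.2]
  have hs0 : ∀ n ≤ (J : ℕ), s n ≠ 0 := by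
    intro n hn
    cases n with
    | zero => simp [s]
    | succ n =>
      have := J.2
      rw [hs1 ⟨n, by omega⟩]
      exact hs _ (Fin.lt_def.2 hn)
  have ht0 : ∀ n, (J : ℕ) + 1 < n → t n ≠ 0 := by
    intro n hn
    by_cases hn' : n - 1 < k + 1
    · simp only [t, dif_pos hn']
      exact ht _ (Fin.lt_def.2 (by simp; omega))
    · simp only [t, dif_neg hn']
      exact one_ne_zero
  have hpre : ∀ n ≤ (J : ℕ) + 1, ∏ m ∈ Finset.range n, u m = s n := by
    intro n
    induction n with
    | zero => simp [s]
    | succ n ih =>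
      intro hn
      have hn' : n ≤ (J : ℕ) := by omega
      rw [Finset.prod_range_succ, ih (by omega)]
      simp only [u, if_pos hn']
      rw [mul_div_cancel₀ _ (hs0 n hn')]
  have hsuf : ∀ n ≤ k + 2, (J : ℕ) + 1 ≤ n → ∏ m ∈ Finset.Ico n (k + 2), u m = t n := by
    intro n hn
    induction hn using Nat.decreasingInduction with
    | self => simp [t]
    | of_succ n hn ih =>
      intro hJ
      have hn' : ¬ n ≤ (J : ℕ) := by omega
      rw [Finset.prod_eq_prod_Ico_succ_bot hn, ih (by omega)]
      simp only [u, if_neg hn']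
      rw [div_mul_cancel₀ _ (ht0 _ (by omega))]
  have htot : ∏ m ∈ Finset.range (k + 2), u m = z (sIdx i J) * z (tIdx i J) := by
    have := J.2
    rw [← Finset.prod_range_mul_prod_Ico u (show (J : ℕ) + 1 ≤ k + 2 by omega), hpre _ le_rfl,
      hsuf _ (by omega) le_rfl, hs1, ht1]
  have hpre' : ∀ c : Fin (k + 1), ∏ m ∈ Finset.range (c + 1), u m = z (sIdx i c) := by
    intro c
    have hc := c.2
    rcases le_or_gt c J with h | h
    · rw [hpre _ (Nat.succ_le_succ h), hs1]
    · apply mul_right_cancel₀ (ht c h)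
      rw [hst, ← htot, ← ht1, ← hsuf _ (by omega) (Nat.succ_le_succ (Fin.le_def.1 h.le)),
        Finset.prod_range_mul_prod_Ico u (by omega)]
  have hsuf' : ∀ c : Fin (k + 1), ∏ m ∈ Finset.Ico ((c : ℕ) + 1) (k + 2), u m =
      z (tIdx i c) := by
    intro c
    have hc := c.2
    rcases lt_or_ge c J with h | h
    · apply mul_left_cancel₀ (hs c h)
      rw [hst, ← htot, ← hs1, ← hpre _ (Nat.succ_le_succ (Fin.le_def.1 h.le)),
        Finset.prod_range_mul_prod_Ico u (by omega)]
    · rw [hsuf _ (by omega) (Nat.succ_le_succ h), ht1]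
  classical
  let x : R → ℂ := fun r => if h : r ∈ Set.range i then u (h.choose : Fin (k + 2))
    else z (yIdx i ⟨r, h⟩)
  have hx : ∀ l : Fin (k + 2), x (i l) = u l := by
    intro l
    have h : i l ∈ Set.range i := ⟨l, rfl⟩
    simp only [x, dif_pos h, hi h.choose_spec]
  refine ⟨x, ?_⟩
  funext p
  rcases p with c | c | r
  · rw [← sIdx, edgeMap_sIdx, ← hpre' c]
    simp only [hx]
    rw [Nat.range_succ_eq_Iic, ← Fin.val_castSucc, ← Fin.map_valEmbedding_Iic, Finset.prod_map]
    rfl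
  · rw [← tIdx, edgeMap_tIdx, ← hsuf' c]
    simp only [hx]
    rw [← Fin.val_succ, ← Fin.map_valEmbedding_Ici, Finset.prod_map]
    rfl
  · rw [← yIdx, edgeMap_yIdx]
    exact dif_neg r.2

end EdgeMap

/-! ### Comparison of the two groups -/

section Group

variable {ι R : Type*} [Fintype ι] {k : ℕ} {e : R → ι → ℤ} {i : Fin (k + 2) → R}

theorem dotProduct_sumElim_zero (w : ι ⊕ Fin k → ℤ) (v : ι → ℤ) :
    w ⬝ᵥ Sum.elim v 0 = (w ∘ Sum.inl) ⬝ᵥ v := by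
  simp [dotProduct]

theorem dotProduct_yGen (w : ι ⊕ Fin k → ℤ) (r : {r : R // r ∉ Set.range i}) :
    w ⬝ᵥ edgeGen e i (yIdx i r) = (w ∘ Sum.inl) ⬝ᵥ e r.1 :=
  dotProduct_sumElim_zero w _

theorem dotProduct_tGen (w : ι ⊕ Fin k → ℤ) (c : Fin (k + 1)) :
    w ⬝ᵥ edgeGen e i (tIdx i c) =
      w ⬝ᵥ edgeGen e i (sIdx i c) + (w ∘ Sum.inl) ⬝ᵥ edgeStep e i := by
  change w ⬝ᵥ (sGen e i c + Sum.elim (edgeStep e i) 0) = w ⬝ᵥ sGen e i c + _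
  rw [dotProduct_add, dotProduct_sumElim_zero]

theorem dotProduct_sGen_castSucc (w : ι ⊕ Fin k → ℤ) (c : Fin k) :
    w ⬝ᵥ edgeGen e i (sIdx i c.castSucc) = w (Sum.inr c) := by
  change w ⬝ᵥ sGen e i c.castSucc = _
  simp [sGen, dotProduct, Pi.single_apply]

theorem dotProduct_sGen_last (w : ι ⊕ Fin k → ℤ) :
    w ⬝ᵥ edgeGen e i (sIdx i (Fin.last k)) =
      (w ∘ Sum.inl) ⬝ᵥ e (i 0) - ∑ c : Fin k, w (Sum.inr c) := by
  change w ⬝ᵥ sGen e i (Fin.last k) = _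
  simp [sGen, dotProduct, sub_eq_add_neg]

theorem sum_dotProduct_sGen (w : ι ⊕ Fin k → ℤ) :
    ∑ c, w ⬝ᵥ edgeGen e i (sIdx i c) = (w ∘ Sum.inl) ⬝ᵥ e (i 0) := by
  rw [Fin.sum_univ_castSucc, dotProduct_sGen_last]
  simp only [dotProduct_sGen_castSucc]
  ring

variable [Fintype {r : R // r ∉ Set.range i}]

theorem prod_eq_prod_mul_prod_notMem_range [Fintype R] {M : Type*} [CommMonoid M]
    (hi : Function.Injective i)
    (f : R → M) : ∏ r, f r = (∏ l, f (i l)) * ∏ r : {r : R // r ∉ Set.range i}, f r.1 := by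
  classical
  rw [← Fintype.prod_subtype_mul_prod_subtype (fun r => r ∈ Set.range i) f]
  congr 1
  · exact (Finset.prod_congr (by ext; simp) fun _ _ => rfl).trans (Fintype.prod_equiv
      (Equiv.ofInjective i hi) (fun l => f (i l)) (fun r => f r.1) fun l => rfl).symm
  · exact Finset.prod_congr (by ext; simp) fun _ _ => rfl

/-- A character of the torus acting on the new coordinates pulls back along `edgeMap` to the
character given by its component in `M`. The exponent of `g_{i_l}` is the sum of the pairings with
the generators of `s_{c+1}` for `c ≥ l` and of `t_c` for `c < l`, and these generators add up to
`e_{i_l}`. -/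
theorem prod_zpow_edgeGen [Fintype R] (hi : Function.Injective i)
    (hsp : ∀ l, e (i l) = e (i 0) + (l : ℤ) • edgeStep e i) {g : R → ℂˣ} {h : EdgeVar i → ℂˣ}
    (hgh : (fun p => (h p : ℂ)) = edgeMap i fun r => (g r : ℂ)) (w : ι ⊕ Fin k → ℤ) :
    ∏ p, h p ^ (w ⬝ᵥ edgeGen e i p) = ∏ r, g r ^ ((w ∘ Sum.inl) ⬝ᵥ e r) := by
  have hs : ∀ c, h (sIdx i c) = ∏ l ∈ Finset.Iic c.castSucc, g (i l) := fun c =>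
    Units.ext (by simpa [edgeMap_sIdx] using congrFun hgh (sIdx i c))
  have ht : ∀ c, h (tIdx i c) = ∏ l ∈ Finset.Ici c.succ, g (i l) := fun c =>
    Units.ext (by simpa [edgeMap_tIdx] using congrFun hgh (tIdx i c))
  have hy : ∀ r, h (yIdx i r) = g r.1 := fun r => Units.ext (congrFun hgh (yIdx i r))
  have hst : ∀ c, h (sIdx i c) * h (tIdx i c) = ∏ l, g (i l) := fun c => by
    rw [hs, ht, prod_Iic_mul_prod_Ici fun l => g (i l)]
  rw [prod_eq_prod_mul_prod_notMem_range hi, Fintype.prod_sum_type, Fintype.prod_sum_type,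
    ← mul_assoc, ← Finset.prod_mul_distrib]
  congr 1
  · calc ∏ c, h (sIdx i c) ^ (w ⬝ᵥ edgeGen e i (sIdx i c)) *
          h (tIdx i c) ^ (w ⬝ᵥ edgeGen e i (tIdx i c))
        = ∏ c, (∏ l, g (i l)) ^ (w ⬝ᵥ edgeGen e i (sIdx i c)) *
            h (tIdx i c) ^ ((w ∘ Sum.inl) ⬝ᵥ edgeStep e i) := by
          refine Finset.prod_congr rfl fun c _ => ?_
          rw [dotProduct_tGen, zpow_add, ← mul_assoc, ← mul_zpow, hst]
      _ = (∏ l, g (i l)) ^ ((w ∘ Sum.inl) ⬝ᵥ e (i 0)) *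
            (∏ l, g (i l) ^ (l : ℕ)) ^ ((w ∘ Sum.inl) ⬝ᵥ edgeStep e i) := by
          rw [Finset.prod_mul_distrib, Finset.prod_zpow, ← sum_dotProduct_sGen w,
            ← prod_prod_Ici fun l => g (i l)]
          congr 1
          · exact (map_prod (zpowersHom ℂˣ (∏ l, g (i l)))
              (fun c => Multiplicative.ofAdd (w ⬝ᵥ edgeGen e i (sIdx i c))) Finset.univ).symm
          · simp only [ht]
      _ = _ := by
          rw [← Finset.prod_zpow, ← Finset.prod_zpow, ← Finset.prod_mul_distrib]
          refine Finset.prod_congr rfl fun l _ => ?_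
          rw [hsp l, dotProduct_add, dotProduct_smul, zpow_add, smul_eq_mul, zpow_mul,
            zpow_natCast]
  · exact Finset.prod_congr rfl fun r _ => by
      change h (yIdx i r) ^ (w ⬝ᵥ edgeGen e i (yIdx i r)) = _
      rw [hy, dotProduct_yGen]

theorem mem_coxGroup_iff_edgeMap [Fintype R] (hi : Function.Injective i)
    (hsp : ∀ l, e (i l) = e (i 0) + (l : ℤ) • edgeStep e i) {g : R → ℂˣ} {h : EdgeVar i → ℂˣ}
    (hgh : (fun p => (h p : ℂ)) = edgeMap i fun r => (g r : ℂ)) :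
    h ∈ coxGroup (edgeGen e i) ↔ g ∈ coxGroup e := by
  constructor
  · intro hh m
    have := hh (Sum.elim m 0)
    rwa [prod_zpow_edgeGen hi hsp hgh, Sum.elim_comp_inl] at this
  · intro hg w
    rw [prod_zpow_edgeGen hi hsp hgh]
    exact hg _

/-- The relation in the group given by the character `v_{c+1}`. -/
theorem mul_eq_mul_of_mem_coxGroup {h : EdgeVar i → ℂˣ} (hh : h ∈ coxGroup (edgeGen e i))
    (c : Fin (k + 1)) : h (sIdx i c) * h (tIdx i c) =
      h (sIdx i (Fin.last k)) * h (tIdx i (Fin.last k)) := by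
  rcases Fin.eq_castSucc_or_eq_last c with ⟨c, rfl⟩ | rfl
  · have hw := hh (Sum.elim 0 (Pi.single c 1))
    rw [Fintype.prod_sum_type, Fintype.prod_sum_type, ← mul_assoc, ← Finset.prod_mul_distrib,
      Fin.prod_univ_castSucc] at hw
    change (∏ b : Fin k, h (sIdx i b.castSucc) ^ (_ ⬝ᵥ edgeGen e i (sIdx i b.castSucc)) *
      h (tIdx i b.castSucc) ^ (_ ⬝ᵥ edgeGen e i (tIdx i b.castSucc))) *
      (h (sIdx i (Fin.last k)) ^ (_ ⬝ᵥ edgeGen e i (sIdx i (Fin.last k))) *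
      h (tIdx i (Fin.last k)) ^ (_ ⬝ᵥ edgeGen e i (tIdx i (Fin.last k)))) *
      (∏ r, h (yIdx i r) ^ (_ ⬝ᵥ edgeGen e i (yIdx i r))) = 1 at hw
    simp only [dotProduct_tGen, dotProduct_yGen, dotProduct_sGen_castSucc, dotProduct_sGen_last,
      Sum.elim_comp_inl, zero_dotProduct, Sum.elim_inr, add_zero, zpow_zero, Finset.prod_const_one,
      mul_one, ← mul_zpow, Finset.sum_pi_single', Finset.mem_univ, if_true, zero_sub,
      zpow_neg, zpow_one] at hw
    rw [Finset.prod_eq_single c] at hw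
    · rw [Pi.single_eq_same, zpow_one, ← mul_inv] at hw
      exact mul_inv_eq_one.1 hw
    · intro b _ hb
      simp [Pi.single_eq_of_ne hb]
    · simp
  · rfl

/-- Every element of the new group comes from the old one, so that `edgeMap` identifies the two
groups. -/
theorem exists_mem_coxGroup_edgeMap_eq [Fintype R] (hi : Function.Injective i)
    (hsp : ∀ l, e (i l) = e (i 0) + (l : ℤ) • edgeStep e i) {h : EdgeVar i → ℂˣ}
    (hh : h ∈ coxGroup (edgeGen e i)) :
    ∃ g ∈ coxGroup e, (fun p => (h p : ℂ)) = edgeMap i fun r => (g r : ℂ) := by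
  obtain ⟨x, hx⟩ := exists_edgeMap_eq hi (z := fun p => (h p : ℂ)) (Fin.last k)
    (fun c _ => (h _).ne_zero) (fun c _ => (h _).ne_zero) fun c => by
      exact_mod_cast congrArg Units.val (mul_eq_mul_of_mem_coxGroup hh c)
  have hx0 : ∀ r, x r ≠ 0 := by
    intro r
    by_cases hr : r ∈ Set.range i
    · obtain ⟨l, rfl⟩ := hr
      have h0 := (h (sIdx i 0) * h (tIdx i 0)).ne_zero
      rw [Units.val_mul, ← congrFun hx, ← congrFun hx, edgeMap_sIdx_mul_tIdx] at h0
      exact Finset.prod_ne_zero_iff.1 h0 l (Finset.mem_univ l)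
    · have h0 := (h (yIdx i ⟨r, hr⟩)).ne_zero
      rwa [← congrFun hx] at h0
  have hgh : (fun p => (h p : ℂ)) = edgeMap i fun r => ((Units.mk0 (x r) (hx0 r) : ℂˣ) : ℂ) :=
    hx.symm
  exact ⟨_, (mem_coxGroup_iff_edgeMap hi hsp hgh).1 hh, hgh⟩

end Group

/-! ### Pull-back of the equations -/

section Pullback

variable {R : Type*} {k : ℕ}

/-- The polynomials in the `x_r` which define `edgeMap`. -/
def edgeMapPoly (i : Fin (k + 2) → R) : EdgeVar i → MvPolynomial R ℂ :=
  Sum.elim (fun j => ∏ l ∈ Finset.Iic j.castSucc, X (i l))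
    (Sum.elim (fun j => ∏ l ∈ Finset.Ici j.succ, X (i l)) (fun r => X r.1))

theorem eval_edgeMapPoly (i : Fin (k + 2) → R) (x : R → ℂ) (p : EdgeVar i) :
    eval x (edgeMapPoly i p) = edgeMap i x p := by
  rcases p with c | c | r
  · simp [edgeMapPoly, edgeMap, map_prod]
  · simp [edgeMapPoly, edgeMap, map_prod]
  · simp [edgeMapPoly, edgeMap]

theorem eval_bind₁_edgeMapPoly (i : Fin (k + 2) → R) (x : R → ℂ)
    (F : MvPolynomial (EdgeVar i) ℂ) :
    eval x (bind₁ (edgeMapPoly i) F) = eval (edgeMap i x) F := by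
  rw [← coe_aeval_eq_eval, RingHom.coe_coe, aeval_bind₁, ← coe_aeval_eq_eval, RingHom.coe_coe]
  congr 2
  funext p
  exact eval_edgeMapPoly i x p

/-- The chain rule for polynomials. -/
theorem pderiv_bind₁ {σ τ A : Type*} [CommRing A] [Fintype σ] (φ : σ → MvPolynomial τ A) (r : τ)
    (F : MvPolynomial σ A) :
    pderiv r (bind₁ φ F) = ∑ p, pderiv r (φ p) * bind₁ φ (pderiv p F) := by
  classical
  induction F using MvPolynomial.induction_on with
  | C a => simp
  | add p q hp hq => simp only [map_add, hp, hq, mul_add, Finset.sum_add_distrib]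
  | mul_X p n hp =>
    simp only [map_mul, pderiv_mul, hp, bind₁_X_right, map_add, pderiv_X, mul_add,
      Finset.sum_add_distrib, Finset.sum_mul]
    congr 1
    · exact Finset.sum_congr rfl fun _ _ => by ring
    · rw [Finset.sum_eq_single n]
      · simp [mul_comm]
      · intro b _ hb
        simp [Pi.single_eq_of_ne hb.symm]
      · simp

theorem edgeMapPoly_sIdx_mul_tIdx (i : Fin (k + 2) → R) (c : Fin (k + 1)) :
    edgeMapPoly i (sIdx i c) * edgeMapPoly i (tIdx i c) = ∏ l, X (i l) :=
  prod_Iic_mul_prod_Ici (fun l => X (i l)) c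

theorem bind₁_binomialEq (i : Fin (k + 2) → R) (j : Fin k) :
    bind₁ (edgeMapPoly i) (binomialEq i j) = 0 := by
  simp only [binomialEq, map_sub, map_mul, bind₁_X_right, edgeMapPoly_sIdx_mul_tIdx, sub_self]

variable {ι : Type*} {e : R → ι → ℤ} {i : Fin (k + 2) → R}

theorem edgeStep_eq (hsp : ∀ l, e (i l) = e (i 0) + (l : ℤ) • edgeStep e i) :
    e (i 1) - e (i 0) = edgeStep e i := by
  rw [hsp 1]; simp

variable [Fintype ι]

theorem neg_one_le_dotProduct {m : ι → ℤ} (hm : toReal m ∈ antiPolytope e) (r : R) :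
    -1 ≤ m ⬝ᵥ e r := by
  have h := hm r
  have h2 : toReal m ⬝ᵥ toReal (e r) = ((m ⬝ᵥ e r : ℤ) : ℝ) := by
    simp [dotProduct, toReal]
  rw [h2] at h
  exact_mod_cast h

/-- Both cases of the definition of `X_m` pull back to the same product, since
`⟨m, e_{i_l}⟩ = ⟨m, e_{i_0}⟩ + l ⟨m, e_{i_1} - e_{i_0}⟩`. -/
theorem bind₁_edgeMonomial (hsp : ∀ l, e (i l) = e (i 0) + (l : ℤ) • edgeStep e i) {m : ι → ℤ}
    (hm : toReal m ∈ antiPolytope e) :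
    bind₁ (edgeMapPoly i) (edgeMonomial e i m) =
      ∏ l, X (i l) ^ (1 + m ⬝ᵥ e (i l)).toNat := by
  have hs : ∏ c, edgeMapPoly i (sIdx i c) = ∏ l, X (i l) ^ (k + 1 - l : ℕ) :=
    prod_prod_Iic fun l => X (i l)
  have ht : ∏ c, edgeMapPoly i (tIdx i c) = ∏ l, X (i l) ^ (l : ℕ) :=
    prod_prod_Ici fun l => X (i l)
  have hml : ∀ l, m ⬝ᵥ e (i l) = m ⬝ᵥ e (i 0) + l * m ⬝ᵥ edgeStep e i := by
    intro l
    rw [hsp l, dotProduct_add, dotProduct_smul, smul_eq_mul]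
  have hneg : m ⬝ᵥ (e (i 0) - e (i 1)) = -(m ⬝ᵥ edgeStep e i) := by
    rw [← neg_sub, edgeStep_eq hsp, dotProduct_neg]
  rw [edgeMonomial, hneg, edgeStep_eq hsp]
  split_ifs with h
  · simp only [map_mul, map_pow, map_prod, bind₁_X_right, edgeMapPoly_sIdx_mul_tIdx, ht]
    rw [← Finset.prod_pow, ← Finset.prod_pow, ← Finset.prod_mul_distrib]
    refine Finset.prod_congr rfl fun l _ => ?_
    rw [← pow_mul, ← pow_add]
    congr 1
    have h0 := neg_one_le_dotProduct hm (i 0)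
    have hl := neg_one_le_dotProduct hm (i l)
    zify
    rw [Int.toNat_of_nonneg (by linarith), Int.toNat_of_nonneg h, Int.toNat_of_nonneg (by linarith),
      hml l]
    ring
  · simp only [map_mul, map_pow, map_prod, bind₁_X_right, edgeMapPoly_sIdx_mul_tIdx, hs]
    rw [← Finset.prod_pow, ← Finset.prod_pow, ← Finset.prod_mul_distrib]
    refine Finset.prod_congr rfl fun l _ => ?_
    rw [← pow_mul, ← pow_add]
    congr 1
    have h0 := neg_one_le_dotProduct hm (i (Fin.last (k + 1)))
    have hl := neg_one_le_dotProduct hm (i l)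
    zify
    rw [Int.toNat_of_nonneg (by linarith), Int.toNat_of_nonneg (by linarith),
      Int.toNat_of_nonneg (by linarith), Nat.cast_sub (by have := l.2; omega), hml l,
      hml (Fin.last _)]
    simp
    ring

theorem bind₁_edgePoly [Fintype R] (hi : Function.Injective i)
    (hsp : ∀ l, e (i l) = e (i 0) + (l : ℤ) • edgeStep e i) {a : (ι → ℤ) →₀ ℂ}
    (ha : ∀ m ∈ a.support, toReal m ∈ antiPolytope e) :
    bind₁ (edgeMapPoly i) (edgePoly e i a) = antiPoly e a := by
  classical
  rw [edgePoly, antiPoly, Finsupp.sum, Finsupp.sum, map_sum]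
  refine Finset.sum_congr rfl fun m hm => ?_
  rw [map_mul, map_mul, bind₁_C_right, bind₁_edgeMonomial hsp (ha m hm), mul_assoc, map_prod,
    prod_eq_prod_mul_prod_notMem_range hi]
  congr 2
  refine Finset.prod_congr (by ext; simp) fun r _ => ?_
  rw [map_pow, bind₁_X_right]
  rfl

end Pullback

/-! ### The Jacobian matrix -/

section Jacobian

variable {R : Type*} {k : ℕ} {i : Fin (k + 2) → R}

theorem eval_pderiv_sIdx_binomialEq (z : EdgeVar i → ℂ) (c : Fin (k + 1)) (j : Fin k) :
    eval z (pderiv (sIdx i c) (binomialEq i j)) =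
      (if j.succ = c then z (tIdx i j.succ) else 0) -
        if j.castSucc = c then z (tIdx i j.castSucc) else 0 := by
  classical
  have h : ∀ b, (b = c) = (sIdx i b = sIdx i c) := fun b => by rw [Sum.inl.injEq]
  simp only [binomialEq, map_sub, pderiv_mul, pderiv_X, Pi.single_apply, reduceCtorEq, if_false,
    mul_zero, add_zero, eval_X, h, apply_ite (eval z), map_zero,
    ite_mul, one_mul, zero_mul, eq_comm]

theorem eval_pderiv_tIdx_binomialEq (z : EdgeVar i → ℂ) (c : Fin (k + 1)) (j : Fin k) :
    eval z (pderiv (tIdx i c) (binomialEq i j)) =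
      (if j.succ = c then z (sIdx i j.succ) else 0) -
        if j.castSucc = c then z (sIdx i j.castSucc) else 0 := by
  classical
  have h : ∀ b, (b = c) = (tIdx i b = tIdx i c) := fun b => by rw [Sum.inr.injEq, Sum.inl.injEq]
  simp only [binomialEq, map_sub, pderiv_mul, pderiv_X, Pi.single_apply, reduceCtorEq, if_false,
    zero_mul, zero_add, eval_X, h, apply_ite (eval z), map_zero,
    mul_ite, mul_one, mul_zero, eq_comm]

/-- Summation by parts: the part of `∑ μ_j (w_{j+1} - w_j)` that involves `w_c`. -/
theorem sum_mul_ite_succ (μ : Fin k → ℂ) (w : Fin (k + 1) → ℂ) (c : Fin (k + 1)) :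
    ∑ j : Fin k, μ j * ((if j.succ = c then w j.succ else 0) -
        if j.castSucc = c then w j.castSucc else 0) =
      ((Fin.cons 0 μ : Fin (k + 1) → ℂ) c - (Fin.snoc μ 0 : Fin (k + 1) → ℂ) c) * w c := by
  have h1 : ∑ j : Fin k, μ j * (if j.succ = c then w j.succ else 0) =
      (Fin.cons 0 μ : Fin (k + 1) → ℂ) c * w c := by
    refine Fin.cases ?_ (fun b => ?_) c
    · simp [Fin.succ_ne_zero]
    · simp
  have h2 : ∑ j : Fin k, μ j * (if j.castSucc = c then w j.castSucc else 0) =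
      (Fin.snoc μ 0 : Fin (k + 1) → ℂ) c * w c := by
    refine Fin.lastCases ?_ (fun b => ?_) c
    · simp [Fin.castSucc_ne_last]
    · simp
  simp only [mul_sub, Finset.sum_sub_distrib, h1, h2, sub_mul]

/-- The gradients of the binomials are linearly independent at a point where one of `s_{c+1}`, `t_c`
is nonzero for each `c ≠ J`: the coefficients of a relation, extended by `0` at both ends, can
change only at `J`. -/
theorem eq_zero_of_sum_mul_pderiv_binomialEq {z : EdgeVar i → ℂ} (J : Fin (k + 1))
    (hs : ∀ c < J, z (sIdx i c) ≠ 0) (ht : ∀ c > J, z (tIdx i c) ≠ 0) {μ : Fin k → ℂ}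
    (hμ : ∀ p, ∑ j, μ j * eval z (pderiv p (binomialEq i j)) = 0) : μ = 0 := by
  have key : ∀ c ≠ J, (Fin.cons 0 μ : Fin (k + 1) → ℂ) c = (Fin.snoc μ 0 : Fin (k + 1) → ℂ) c := by
    intro c hc
    rcases lt_or_gt_of_ne hc with h | h
    · have := hμ (tIdx i c)
      simp only [eval_pderiv_tIdx_binomialEq] at this
      rw [sum_mul_ite_succ μ (fun c => z (sIdx i c))] at this
      exact sub_eq_zero.1 ((mul_eq_zero.1 this).resolve_right (hs c h))
    · have := hμ (sIdx i c)
      simp only [eval_pderiv_sIdx_binomialEq] at this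
      rw [sum_mul_ite_succ μ (fun c => z (tIdx i c))] at this
      exact sub_eq_zero.1 ((mul_eq_zero.1 this).resolve_right (ht c h))
  have hlow : ∀ n (hn : n < k), n < J → μ ⟨n, hn⟩ = 0 := by
    intro n
    induction n with
    | zero =>
      intro hn hJ
      have := key (Fin.castSucc ⟨0, hn⟩) (fun h => by rw [← h] at hJ; simp at hJ)
      rw [Fin.snoc_castSucc] at this
      exact this.symm
    | succ n ih =>
      intro hn hJ
      have := key (Fin.castSucc ⟨n + 1, hn⟩) (fun h => by rw [← h] at hJ; simp at hJ)
      rw [Fin.snoc_castSucc] at this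
      rw [← this, ← ih (by omega) (by omega)]
      exact Fin.cons_succ (α := fun _ => ℂ) 0 μ ⟨n, by omega⟩
  have hhigh : ∀ j : Fin k, (J : ℕ) ≤ j → μ j = 0 := by
    intro j
    induction j using WellFoundedGT.induction with
    | ind j ih =>
      intro hJ
      have := key j.succ (fun h => by rw [← h] at hJ; simp at hJ)
      rw [Fin.cons_succ] at this
      rw [this]
      rcases Fin.eq_castSucc_or_eq_last j.succ with ⟨b, hb⟩ | hb
      · rw [hb, Fin.snoc_castSucc]
        have hb' : (b : ℕ) = j + 1 := by simpa using (congrArg Fin.val hb).symm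
        exact ih b (Fin.lt_def.2 (by omega)) (by omega)
      · rw [hb, Fin.snoc_last]
  funext j
  rcases lt_or_ge (j : ℕ) J with h | h
  · exact hlow j j.2 h
  · exact hhigh j h

variable {ι : Type*} [Fintype ι] [Fintype R] {e : R → ι → ℤ}

/-- A relation between the gradients of the equations pulls back, by the chain rule, to a relation
that involves the gradient of `antiPoly e a` alone, so the coefficient of the last equation
vanishes. The binomials are independent by `eq_zero_of_sum_mul_pderiv_binomialEq`. -/
theorem rank_jacobian_edgeEqs [Fintype {r : R // r ∉ Set.range i}]
    (hi : Function.Injective i) (hsp : ∀ l, e (i l) = e (i 0) + (l : ℤ) • edgeStep e i)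
    {a : (ι → ℤ) →₀ ℂ} (ha : ∀ m ∈ a.support, toReal m ∈ antiPolytope e) {x : R → ℂ}
    (hx : ∃ r, eval x (pderiv r (antiPoly e a)) ≠ 0) (J : Fin (k + 1))
    (hs : ∀ c < J, edgeMap i x (sIdx i c) ≠ 0) (ht : ∀ c > J, edgeMap i x (tIdx i c) ≠ 0) :
    (Matrix.of fun (c : Fin k ⊕ Unit) (p : EdgeVar i) =>
      eval (edgeMap i x) (pderiv p (edgeEqs e i a c))).rank = Fintype.card (Fin k ⊕ Unit) := by
  apply LinearIndependent.rank_matrix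
  rw [Fintype.linearIndependent_iff]
  intro ν hν
  have hν' : ∀ p, ∑ j, ν (Sum.inl j) * eval (edgeMap i x) (pderiv p (binomialEq i j)) +
      ν (Sum.inr ()) * eval (edgeMap i x) (pderiv p (edgePoly e i a)) = 0 := by
    intro p
    have := congrFun hν p
    rw [Fintype.sum_sum_type] at this
    simpa [edgeEqs, Matrix.row] using this
  -- The chain rule for the pull-back of the relation along `edgeMap`.
  have hpull : ∀ r (F : MvPolynomial (EdgeVar i) ℂ),
      ∑ p, eval x (pderiv r (edgeMapPoly i p)) * eval (edgeMap i x) (pderiv p F) =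
        eval x (pderiv r (bind₁ (edgeMapPoly i) F)) := by
    intro r F
    simp only [pderiv_bind₁, map_sum, map_mul, eval_bind₁_edgeMapPoly]
  have hlast : ν (Sum.inr ()) = 0 := by
    obtain ⟨r, hr⟩ := hx
    have h0 : ∑ p, eval x (pderiv r (edgeMapPoly i p)) *
        (∑ j, ν (Sum.inl j) * eval (edgeMap i x) (pderiv p (binomialEq i j)) +
          ν (Sum.inr ()) * eval (edgeMap i x) (pderiv p (edgePoly e i a))) = 0 := by
      simp only [hν', mul_zero, Finset.sum_const_zero]
    simp only [mul_add, Finset.sum_add_distrib, Finset.mul_sum] at h0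
    rw [Finset.sum_comm] at h0
    simp only [mul_left_comm _ (ν _), ← Finset.mul_sum, hpull, bind₁_binomialEq, map_zero,
      mul_zero, Finset.sum_const_zero, zero_add, bind₁_edgePoly hi hsp ha] at h0
    exact (mul_eq_zero.1 h0).resolve_right hr
  have hμ := eq_zero_of_sum_mul_pderiv_binomialEq (μ := fun j => ν (Sum.inl j)) J hs ht fun p => by
    simpa [hlast] using hν' p
  rintro (j | ⟨⟩)
  · exact congrFun hμ j
  · exact hlast

end Jacobian

/-! ### Homogeneity -/

section Homogeneity

/-- The relation between the classes of the torus-invariant divisors given by `m`. -/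
theorem sum_dotProduct_smul_degVar {ι R : Type*} [Fintype ι] [Fintype R] (e : R → ι → ℤ)
    (m : ι → ℤ) : ∑ r, (m ⬝ᵥ e r) • degVar e r = 0 := by
  classical
  have h : ∑ r, (m ⬝ᵥ e r) • degVar e r =
      Submodule.Quotient.mk (∑ r, (m ⬝ᵥ e r) • (Pi.single r 1 : R → ℤ)) := by
    rw [← Submodule.mkQ_apply, map_sum]
    refine Finset.sum_congr rfl fun r _ => ?_
    rw [map_smul, Submodule.mkQ_apply, degVar]
  rw [h, Submodule.Quotient.mk_eq_zero]
  refine ⟨m, ?_⟩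
  funext r
  simp [Finset.sum_apply, Pi.single_apply]

variable {ι R : Type*} [Fintype ι] {k : ℕ} {e : R → ι → ℤ} {i : Fin (k + 2) → R}
  [Fintype {r : R // r ∉ Set.range i}]

/-- The same relation for the new fan, parametrized by `m` and the pairings `f c` with the
generators of the `s_{c+1}`. These are subject to one condition, as the generators add up to
`e_{i_0}`. -/
theorem sum_smul_degVar_edgeGen (m : ι → ℤ) (f : Fin (k + 1) → ℤ)
    (hf : ∑ c, f c = m ⬝ᵥ e (i 0)) :
    ∑ c, f c • degVar (edgeGen e i) (sIdx i c) +
      (∑ c, (f c + m ⬝ᵥ edgeStep e i) • degVar (edgeGen e i) (tIdx i c) +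
      ∑ r, (m ⬝ᵥ e r.1) • degVar (edgeGen e i) (yIdx i r)) = 0 := by
  have hs : ∀ c, (Sum.elim m fun c : Fin k => f c.castSucc) ⬝ᵥ edgeGen e i (sIdx i c) = f c := by
    intro c
    rcases Fin.eq_castSucc_or_eq_last c with ⟨c, rfl⟩ | rfl
    · rw [dotProduct_sGen_castSucc, Sum.elim_inr]
    · rw [dotProduct_sGen_last, Sum.elim_comp_inl, ← hf, Fin.sum_univ_castSucc]
      simp
  have h := sum_dotProduct_smul_degVar (edgeGen e i) (Sum.elim m fun c : Fin k => f c.castSucc)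
  rw [Fintype.sum_sum_type, Fintype.sum_sum_type] at h
  have ht : ∀ c, (Sum.elim m fun c : Fin k => f c.castSucc) ⬝ᵥ edgeGen e i (tIdx i c) =
      f c + m ⬝ᵥ edgeStep e i := by
    intro c
    rw [dotProduct_tGen, hs, Sum.elim_comp_inl]
  have hy : ∀ r, (Sum.elim m fun c : Fin k => f c.castSucc) ⬝ᵥ edgeGen e i (yIdx i r) =
      m ⬝ᵥ e r.1 := by
    intro r
    rw [dotProduct_yGen, Sum.elim_comp_inl]
  simpa only [hs, ht, hy] using h

theorem isHomogeneousPoly_binomialEq (j : Fin k) :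
    IsHomogeneousPoly (edgeGen e i) (binomialEq i j) := by
  refine ⟨degVar _ (sIdx i j.succ) + degVar _ (tIdx i j.succ), ?_⟩
  refine ((isWeightedHomogeneous_X _ _ _).mul (isWeightedHomogeneous_X _ _ _)).sub ?_
  have h := sum_smul_degVar_edgeGen (e := e) (i := i) 0
    (Pi.single j.succ 1 - Pi.single j.castSucc 1) (by simp)
  simp only [Pi.sub_apply, zero_dotProduct, add_zero, sub_smul, Finset.sum_sub_distrib,
    Pi.single_apply, ite_smul, one_smul, zero_smul, Finset.sum_ite_eq', Finset.mem_univ, if_true,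
    Finset.sum_const_zero] at h
  have h' : degVar (edgeGen e i) (sIdx i j.succ) + degVar (edgeGen e i) (tIdx i j.succ) =
      degVar (edgeGen e i) (sIdx i j.castSucc) + degVar (edgeGen e i) (tIdx i j.castSucc) := by
    rw [← sub_eq_zero, ← h]
    abel
  rw [h']
  exact (isWeightedHomogeneous_X _ _ _).mul (isWeightedHomogeneous_X _ _ _)

theorem isHomogeneousPoly_edgePoly [Fintype R]
    (hsp : ∀ l, e (i l) = e (i 0) + (l : ℤ) • edgeStep e i) {a : (ι → ℤ) →₀ ℂ}
    (ha : ∀ m ∈ a.support, toReal m ∈ antiPolytope e) :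
    IsHomogeneousPoly (edgeGen e i) (edgePoly e i a) := by
  refine ⟨degVar _ (sIdx i 0) + degVar _ (tIdx i 0) + ∑ r, degVar _ (yIdx i r), ?_⟩
  rw [edgePoly, Finsupp.sum]
  refine IsWeightedHomogeneous.sum _ _ _ fun m hm => ?_
  have hm' := neg_one_le_dotProduct (ha m hm)
  have hneg : m ⬝ᵥ (e (i 0) - e (i 1)) = -(m ⬝ᵥ edgeStep e i) := by
    rw [← neg_sub, edgeStep_eq hsp, dotProduct_neg]
  have hlast : m ⬝ᵥ e (i (Fin.last (k + 1))) =
      m ⬝ᵥ e (i 0) + ((k : ℤ) + 1) * m ⬝ᵥ edgeStep e i := by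
    rw [hsp (Fin.last (k + 1)), dotProduct_add, dotProduct_smul, smul_eq_mul]
    simp
  have hnat : ∀ {z : ℤ} (x : ClassGp (edgeGen e i)), 0 ≤ z → z.toNat • x = z • x := by
    intro z x hz
    rw [← natCast_zsmul, Int.toNat_of_nonneg hz]
  have hX : ∀ p, IsWeightedHomogeneous (degVar (edgeGen e i)) (X p : MvPolynomial _ ℂ)
      (degVar (edgeGen e i) p) := fun p => isWeightedHomogeneous_X _ _ _
  have hy : IsWeightedHomogeneous (degVar (edgeGen e i))
      (∏ r : {r : R // r ∉ Set.range i},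
        (X (yIdx i r) : MvPolynomial (EdgeVar i) ℂ) ^ (1 + m ⬝ᵥ e r.1).toNat)
      (∑ r, degVar (edgeGen e i) (yIdx i r) +
        ∑ r, (m ⬝ᵥ e r.1) • degVar (edgeGen e i) (yIdx i r)) := by
    rw [← Finset.sum_add_distrib]
    refine IsWeightedHomogeneous.prod _ _ _ fun r _ => ?_
    have := (hX (yIdx i r)).pow (1 + m ⬝ᵥ e r.1).toNat
    rwa [hnat _ (by linarith [hm' r.1]), add_smul, one_smul] at this
  have hy' : ∀ {d : ClassGp (edgeGen e i)},
      IsWeightedHomogeneous (degVar (edgeGen e i)) (edgeMonomial e i m) d →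
      d + ∑ r, (m ⬝ᵥ e r.1) • degVar (edgeGen e i) (yIdx i r) =
        degVar _ (sIdx i 0) + degVar _ (tIdx i 0) →
      IsWeightedHomogeneous (degVar (edgeGen e i)) (C (a m) * edgeMonomial e i m *
        ∏ r : {r : R // r ∉ Set.range i},
          (X (yIdx i r) : MvPolynomial (EdgeVar i) ℂ) ^ (1 + m ⬝ᵥ e r.1).toNat)
        (degVar _ (sIdx i 0) + degVar _ (tIdx i 0) + ∑ r, degVar _ (yIdx i r)) := by
    intro d hd hsum
    rw [mul_assoc, ← hsum, add_right_comm, add_assoc]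
    exact (hd.mul hy).C_mul (a m)
  have hst := (hX (sIdx i 0)).mul (hX (tIdx i 0))
  suffices h : IsWeightedHomogeneous (degVar (edgeGen e i)) (C (a m) * edgeMonomial e i m *
        ∏ r : {r : R // r ∉ Set.range i},
          (X (yIdx i r) : MvPolynomial (EdgeVar i) ℂ) ^ (1 + m ⬝ᵥ e r.1).toNat)
        (degVar _ (sIdx i 0) + degVar _ (tIdx i 0) + ∑ r, degVar _ (yIdx i r)) by
    convert h
  by_cases h : 0 ≤ m ⬝ᵥ edgeStep e i
  · have hmon : edgeMonomial e i m = (X (sIdx i 0) * X (tIdx i 0)) ^ (1 + m ⬝ᵥ e (i 0)).toNat *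
        (∏ j, X (tIdx i j)) ^ (m ⬝ᵥ edgeStep e i).toNat := by
      rw [edgeMonomial, edgeStep_eq hsp, if_pos h]
    have hd := (hst.pow (1 + m ⬝ᵥ e (i 0)).toNat).mul
      ((IsWeightedHomogeneous.prod Finset.univ _ _ fun c _ => hX (tIdx i c)).pow
        (m ⬝ᵥ edgeStep e i).toNat)
    rw [← hmon, hnat _ (by linarith [hm' (i 0)]), hnat _ h] at hd
    refine hy' hd ?_
    -- The exponents of the `s` and `t` in the monomial, without the `1` at `s_1` and `t_0`, are the
    -- pairings with an element of the dual lattice.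
    have hrel := sum_smul_degVar_edgeGen (e := e) (i := i) m (Pi.single 0 (m ⬝ᵥ e (i 0))) (by simp)
    simp only [Pi.single_apply, ite_smul, zero_smul, Finset.sum_ite_eq', Finset.mem_univ, if_true,
      add_smul, Finset.sum_add_distrib, ← Finset.smul_sum] at hrel
    rw [← sub_eq_zero, ← hrel, add_smul, one_smul, smul_add]
    abel
  · have hmon : edgeMonomial e i m = (X (sIdx i 0) * X (tIdx i 0)) ^
        (1 + m ⬝ᵥ e (i (Fin.last (k + 1)))).toNat *
        (∏ j, X (sIdx i j)) ^ (-(m ⬝ᵥ edgeStep e i)).toNat := by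
      rw [edgeMonomial, edgeStep_eq hsp, if_neg h, hneg]
    have hd := (hst.pow (1 + m ⬝ᵥ e (i (Fin.last (k + 1)))).toNat).mul
      ((IsWeightedHomogeneous.prod Finset.univ _ _ fun c _ => hX (sIdx i c)).pow
        (-(m ⬝ᵥ edgeStep e i)).toNat)
    rw [← hmon, hnat _ (by linarith [hm' (i (Fin.last (k + 1)))]), hnat _ (by linarith)] at hd
    refine hy' hd ?_
    -- Here the pairings with the generators of all `s` carry the summand `-⟨m, e_{i_1} - e_{i_0}⟩`.
    have hrel := sum_smul_degVar_edgeGen (e := e) (i := i) m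
      (fun c => (Pi.single 0 (m ⬝ᵥ e (i (Fin.last (k + 1)))) : Fin (k + 1) → ℤ) c +
        -(m ⬝ᵥ edgeStep e i)) (by simp [Finset.sum_add_distrib, hlast])
    simp only [neg_add_cancel_right, Pi.single_apply, ite_smul, zero_smul, Finset.sum_ite_eq',
      Finset.mem_univ, if_true, add_smul, Finset.sum_add_distrib, ← Finset.smul_sum] at hrel
    rw [← sub_eq_zero, ← hrel, add_smul, one_smul, smul_add]
    abel

end Homogeneity

/-! ### Comparison of the two open sets -/

section ConeCorrespondence

variable {ι R : Type*} {k : ℕ} {S : Set (PointedCone ℝ (ι → ℝ))} {e : R → ι → ℤ}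
  {i : Fin (k + 2) → R}

theorem IsEdgeConeGens.edgeMap_ne_zero {σ : PointedCone ℝ (ι → ℝ)} {A : Set (EdgeVar i)}
    (hA : IsEdgeConeGens e i σ A) {x : R → ℂ} (hx : ∀ r, toReal (e r) ∉ σ → x r ≠ 0)
    {p : EdgeVar i} (hp : p ∉ A) : edgeMap i x p ≠ 0 := by
  rcases p with c | c | r
  · exact edgeMap_sIdx_ne_zero_iff.2 fun l hl => hx _ fun hl' =>
      hp ((hA.sIdx_mem_iff c).2 ⟨l, hl, hl'⟩)
  · exact edgeMap_tIdx_ne_zero_iff.2 fun l hl => hx _ fun hl' =>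
      hp ((hA.tIdx_mem_iff c).2 ⟨l, hl, hl'⟩)
  · exact hx _ fun hr => hp ((hA.yIdx_mem_iff r).2 hr)

theorem IsEdgeConeGens.ne_zero_of_edgeMap {σ : PointedCone ℝ (ι → ℝ)} {A : Set (EdgeVar i)}
    (hA : IsEdgeConeGens e i σ A) {x : R → ℂ} (hx : ∀ p ∉ A, edgeMap i x p ≠ 0)
    {r : R} (hr : toReal (e r) ∉ σ) : x r ≠ 0 := by
  by_cases hri : r ∈ Set.range i
  · obtain ⟨l, rfl⟩ := hri
    rcases hA.sIdx_or_tIdx_notMem hr with ⟨c, rfl, hc⟩ | ⟨c, rfl, hc⟩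
    · exact edgeMap_sIdx_ne_zero_iff.1 (hx _ hc) _ le_rfl
    · exact edgeMap_tIdx_ne_zero_iff.1 (hx _ hc) _ le_rfl
  · exact hx (yIdx i ⟨r, hri⟩) fun h => hr ((hA.yIdx_mem_iff ⟨r, hri⟩).1 h)

theorem IsEdgeConeGens.exists_split_notMem {σ : PointedCone ℝ (ι → ℝ)} {A : Set (EdgeVar i)}
    (hA : IsEdgeConeGens e i σ A) :
    ∃ J : Fin (k + 1), (∀ c < J, sIdx i c ∉ A) ∧ ∀ c > J, tIdx i c ∉ A := by
  obtain ⟨J, hJ⟩ := hA.exists_split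
  refine ⟨J, fun c hc hcA => ?_, fun c hc hcA => ?_⟩
  · obtain ⟨l, hlc, hl⟩ := (hA.sIdx_mem_iff c).1 hcA
    rw [Fin.le_def] at hlc
    rw [Fin.lt_def] at hc
    rcases hJ l hl with rfl | rfl <;> simp at hlc <;> omega
  · obtain ⟨l, hlc, hl⟩ := (hA.tIdx_mem_iff c).1 hcA
    rw [ge_iff_le, Fin.le_def] at hlc
    rw [gt_iff_lt, Fin.lt_def] at hc
    rcases hJ l hl with rfl | rfl <;> simp at hlc <;> omega

theorem edgeMap_mem_coxOpen (hA : ∀ σ ∈ S, ∃ A, IsEdgeConeGens e i σ A) {x : R → ℂ}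
    (hx : x ∈ coxOpen S e) : edgeMap i x ∈ coxOpen (edgeFan S e i) (edgeGen e i) := by
  obtain ⟨σ, hσ, hx⟩ := hx
  obtain ⟨A, hA⟩ := hA σ hσ
  exact ⟨_, ⟨σ, hσ, A, hA, PointedCone.IsFaceOf.refl _⟩, fun p hp =>
    hA.edgeMap_ne_zero hx fun hpA => hp (PointedCone.subset_hull ⟨p, hpA, rfl⟩)⟩

theorem exists_gens_of_mem_coxOpen_edgeFan
    (hsp : ∀ l, e (i l) = e (i 0) + (l : ℤ) • edgeStep e i) {z : EdgeVar i → ℂ}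
    (hz : z ∈ coxOpen (edgeFan S e i) (edgeGen e i)) :
    ∃ σ ∈ S, ∃ A, IsEdgeConeGens e i σ A ∧ ∀ p ∉ A, z p ≠ 0 := by
  obtain ⟨τ, ⟨σ, hσ, A, hA, hτ⟩, hz⟩ := hz
  exact ⟨σ, hσ, A, hA, fun p hp => hz p fun hpτ => hp (hA.mem_of_mem_hull hsp (hτ.le hpτ))⟩

/-- The common zero locus of the binomials in the new open set is contained in the image of
`edgeMap`. -/
theorem exists_preimage_of_binomialEq (hi : Function.Injective i)
    (hsp : ∀ l, e (i l) = e (i 0) + (l : ℤ) • edgeStep e i) {z : EdgeVar i → ℂ}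
    (hz : z ∈ coxOpen (edgeFan S e i) (edgeGen e i))
    (hbin : ∀ j, eval z (binomialEq i j) = 0) :
    ∃ x ∈ coxOpen S e, edgeMap i x = z ∧ ∃ J : Fin (k + 1),
      (∀ c < J, z (sIdx i c) ≠ 0) ∧ ∀ c > J, z (tIdx i c) ≠ 0 := by
  obtain ⟨σ, hσ, A, hA, hzA⟩ := exists_gens_of_mem_coxOpen_edgeFan hsp hz
  obtain ⟨J, hJs, hJt⟩ := hA.exists_split_notMem
  have hs : ∀ c < J, z (sIdx i c) ≠ 0 := fun c hc => hzA _ (hJs c hc)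
  have ht : ∀ c > J, z (tIdx i c) ≠ 0 := fun c hc => hzA _ (hJt c hc)
  have hconst : ∀ c, z (sIdx i c) * z (tIdx i c) = z (sIdx i 0) * z (tIdx i 0) := by
    intro c
    induction c using Fin.induction with
    | zero => rfl
    | succ c ih =>
      rw [← ih, ← sub_eq_zero]
      simpa [binomialEq] using hbin c
  obtain ⟨x, hx⟩ := exists_edgeMap_eq hi J hs ht fun c => (hconst c).trans (hconst J).symm
  exact ⟨x, ⟨σ, hσ, fun r hr => hA.ne_zero_of_edgeMap (hx ▸ hzA) hr⟩, hx, J, hs, ht⟩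

theorem exists_split_of_mem_coxOpen (hA : ∀ σ ∈ S, ∃ A, IsEdgeConeGens e i σ A) {x : R → ℂ}
    (hx : x ∈ coxOpen S e) :
    ∃ J : Fin (k + 1), ∀ l, x (i l) = 0 → l = J.castSucc ∨ l = J.succ := by
  obtain ⟨σ, hσ, hx⟩ := hx
  obtain ⟨A, hA⟩ := hA σ hσ
  obtain ⟨J, hJ⟩ := hA.exists_split
  exact ⟨J, fun l hl => hJ l (by_contra fun h => hx _ h hl)⟩

end ConeCorrespondence

/-! ### The map of toric varieties -/

section Map

variable {ι R : Type*} [Fintype ι] [Fintype R] {k : ℕ} {S : Set (PointedCone ℝ (ι → ℝ))}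
  {e : R → ι → ℤ} {i : Fin (k + 2) → R} [Fintype {r : R // r ∉ Set.range i}]

theorem toricPoint_eq_iff {x y : R → ℂ} (hx : x ∈ coxOpen S e) (hy : y ∈ coxOpen S e) :
    toricPoint S e x hx = toricPoint S e y hy ↔
      ∃ g ∈ coxGroup e, y = (fun r => (g r : ℂ)) * x := by
  refine Quotient.eq.trans (exists_congr fun g => and_congr_right fun _ => ?_)
  exact ⟨fun h => funext h, fun h => congrFun h⟩

/-- `edgeMap` is well defined and injective on orbits. -/
theorem toricPoint_edgeMap_eq_iff (hA : ∀ σ ∈ S, ∃ A, IsEdgeConeGens e i σ A)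
    (hi : Function.Injective i) (hsp : ∀ l, e (i l) = e (i 0) + (l : ℤ) • edgeStep e i)
    {x y : R → ℂ} (hx : x ∈ coxOpen S e) (hy : y ∈ coxOpen S e) :
    toricPoint (edgeFan S e i) (edgeGen e i) (edgeMap i x) (edgeMap_mem_coxOpen hA hx) =
      toricPoint (edgeFan S e i) (edgeGen e i) (edgeMap i y) (edgeMap_mem_coxOpen hA hy) ↔
    toricPoint S e x hx = toricPoint S e y hy := by
  rw [toricPoint_eq_iff, toricPoint_eq_iff]
  constructor
  · rintro ⟨h, hh, hxy⟩
    obtain ⟨g, hg, hgh⟩ := exists_mem_coxGroup_edgeMap_eq hi hsp hh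
    refine ⟨g, hg, ?_⟩
    obtain ⟨J, hJ⟩ := exists_split_of_mem_coxOpen hA hy
    refine edgeMap_eq_of_edgeMap_eq J hJ ?_
    rw [hxy, hgh, edgeMap_mul]
  · rintro ⟨g, hg, rfl⟩
    have h0 : ∀ p, edgeMap i (fun r => (g r : ℂ)) p ≠ 0 := by
      rintro (c | c | r)
      · exact edgeMap_sIdx_ne_zero_iff.2 fun l _ => (g (i l)).ne_zero
      · exact edgeMap_tIdx_ne_zero_iff.2 fun l _ => (g (i l)).ne_zero
      · exact (g r.1).ne_zero
    refine ⟨fun p => Units.mk0 _ (h0 p), (mem_coxGroup_iff_edgeMap hi hsp rfl).2 hg, ?_⟩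
    rw [edgeMap_mul]
    rfl

/-- The map of toric varieties given by `edgeMap` in homogeneous coordinates. -/
def toricEdgeMap (hA : ∀ σ ∈ S, ∃ A, IsEdgeConeGens e i σ A)
    (hi : Function.Injective i) (hsp : ∀ l, e (i l) = e (i 0) + (l : ℤ) • edgeStep e i) :
    ToricVariety S e → ToricVariety (edgeFan S e i) (edgeGen e i) :=
  Quotient.lift
    (fun x => toricPoint (edgeFan S e i) (edgeGen e i) (edgeMap i x.1)
      (edgeMap_mem_coxOpen hA x.2))
    fun x y hxy => (toricPoint_edgeMap_eq_iff hA hi hsp x.2 y.2).2 (Quotient.sound hxy)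

theorem toricEdgeMap_injective (hA : ∀ σ ∈ S, ∃ A, IsEdgeConeGens e i σ A)
    (hi : Function.Injective i) (hsp : ∀ l, e (i l) = e (i 0) + (l : ℤ) • edgeStep e i) :
    Function.Injective (toricEdgeMap hA hi hsp) := by
  rintro ⟨x, hx⟩ ⟨y, hy⟩ h
  exact (toricPoint_edgeMap_eq_iff hA hi hsp hx hy).1 h

theorem image_toricEdgeMap_zeroLocus (hA : ∀ σ ∈ S, ∃ A, IsEdgeConeGens e i σ A)
    (hi : Function.Injective i) (hsp : ∀ l, e (i l) = e (i 0) + (l : ℤ) • edgeStep e i)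
    {a : (ι → ℤ) →₀ ℂ} (ha : ∀ m ∈ a.support, toReal m ∈ antiPolytope e) :
    toricEdgeMap hA hi hsp '' zeroLocus S e (fun _ : Unit => antiPoly e a) =
      zeroLocus (edgeFan S e i) (edgeGen e i) (edgeEqs e i a) := by
  ext P
  constructor
  · rintro ⟨_, ⟨x, hx, rfl, hfx⟩, rfl⟩
    refine ⟨edgeMap i x, edgeMap_mem_coxOpen hA hx, rfl, ?_⟩
    rintro (j | ⟨⟩)
    · change eval (edgeMap i x) (binomialEq i j) = 0
      rw [← eval_bind₁_edgeMapPoly, bind₁_binomialEq, map_zero]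
    · change eval (edgeMap i x) (edgePoly e i a) = 0
      rw [← eval_bind₁_edgeMapPoly, bind₁_edgePoly hi hsp ha]
      exact hfx ()
  · rintro ⟨z, hz, rfl, hfz⟩
    obtain ⟨x, hx, rfl, -⟩ := exists_preimage_of_binomialEq hi hsp hz fun j => hfz (Sum.inl j)
    refine ⟨_, ⟨x, hx, rfl, fun _ => ?_⟩, rfl⟩
    rw [← bind₁_edgePoly hi hsp ha, eval_bind₁_edgeMapPoly]
    exact hfz (Sum.inr ())

theorem isQuasismoothCI_edgeEqs
    (hi : Function.Injective i) (hsp : ∀ l, e (i l) = e (i 0) + (l : ℤ) • edgeStep e i)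
    {a : (ι → ℤ) →₀ ℂ} (ha : ∀ m ∈ a.support, toReal m ∈ antiPolytope e)
    (hX : IsNondegenerate S e (antiPoly e a)) :
    IsQuasismoothCI (edgeFan S e i) (edgeGen e i) (edgeEqs e i a) where
  homogeneous := by
    rintro (j | ⟨⟩)
    · exact isHomogeneousPoly_binomialEq j
    · exact isHomogeneousPoly_edgePoly hsp ha
  jacobian := by
    intro z hz hfz
    obtain ⟨x, hx, rfl, J, hs, ht⟩ :=
      exists_preimage_of_binomialEq hi hsp hz fun j => hfz (Sum.inl j)
    obtain ⟨r, hr⟩ := hX x hx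
    exact rank_jacobian_edgeEqs hi hsp ha ⟨r, right_ne_zero_of_mul hr⟩ J hs ht

end Map

theorem ne_zero_of_mem_frontier {ι R : Type*} [Fintype ι] {e : R → ι → ℤ} {P : Set (ι → ℝ)}
    (hP : IsLatticePolytopeWithCenter P) {r : R} (hr : toReal (e r) ∈ frontier P) : e r ≠ 0 :=
  fun h => hr.2 ((hP.2 _).2 h)

end ToricCI
end

theorem mainTheorem3 {d n k : ℕ} (S : Set (PointedCone ℝ (Fin d → ℝ))) (e : Fin n → Fin d → ℤ)
    (hfan : ToricCI.IsFan S) (hcomplete : ToricCI.IsComplete S)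
    (hsimplicial : ToricCI.IsSimplicial S) (he : ToricCI.IsRayGenerators S e)
    (hsemiample : ToricCI.IsSemiampleAnticanonical S e)
    (hreflexive : ToricCI.IsReflexive (ToricCI.antiPolytope e))
    (hboundary : ∀ r, ToricCI.toReal (e r) ∈
      frontier (ToricCI.dualPolytope (ToricCI.antiPolytope e)))
    (Γ : Set (Fin d → ℝ))
    (hΓ : ToricCI.IsEdge (ToricCI.dualPolytope (ToricCI.antiPolytope e)) Γ)
    (i : Fin (k + 2) → Fin n) (hi : ToricCI.ListsLatticePoints Γ e i)
    (a : (Fin d → ℤ) →₀ ℂ)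
    (ha : ∀ m ∈ a.support, ToricCI.toReal m ∈ ToricCI.antiPolytope e)
    (hX : ToricCI.IsNondegenerate S e (ToricCI.antiPoly e a)) :
    (∃ φ : ToricCI.ToricVariety S e →
        ToricCI.ToricVariety (ToricCI.edgeFan S e i) (ToricCI.edgeGen e i),
      (∀ (x : Fin n → ℂ) (hx : x ∈ ToricCI.coxOpen S e),
        ∃ hx' : ToricCI.edgeMap i x ∈
            ToricCI.coxOpen (ToricCI.edgeFan S e i) (ToricCI.edgeGen e i),
          φ (ToricCI.toricPoint S e x hx) =
            ToricCI.toricPoint (ToricCI.edgeFan S e i) (ToricCI.edgeGen e i)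
              (ToricCI.edgeMap i x) hx') ∧
      Function.Injective φ ∧
      φ '' ToricCI.zeroLocus S e (fun _ : Unit => ToricCI.antiPoly e a) =
        ToricCI.zeroLocus (ToricCI.edgeFan S e i) (ToricCI.edgeGen e i)
          (ToricCI.edgeEqs e i a)) ∧
    ToricCI.IsQuasismoothCI (ToricCI.edgeFan S e i) (ToricCI.edgeGen e i)
      (ToricCI.edgeEqs e i a) := by
  have hne : ∀ r, e r ≠ 0 := fun r =>
    ToricCI.ne_zero_of_mem_frontier hreflexive.2 (hboundary r)
  have hA : ∀ σ ∈ S, ∃ A, ToricCI.IsEdgeConeGens e i σ A := fun σ hσ =>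
    ToricCI.exists_isEdgeConeGens fun _ _ hab ha hb =>
      hi.eq_add_one_of_mem hfan he hne hσ hab ha hb
  have hsp := hi.eq_add_smul_edgeStep (hΓ.1.convex (ToricCI.convex_dualPolytope _)) he.injective
  exact ⟨⟨ToricCI.toricEdgeMap hA hi.injective hsp,
    fun x hx => ⟨ToricCI.edgeMap_mem_coxOpen hA hx, rfl⟩,
    ToricCI.toricEdgeMap_injective hA hi.injective hsp,
    ToricCI.image_toricEdgeMap_zeroLocus hA hi.injective hsp ha⟩,
    ToricCI.isQuasismoothCI_edgeEqs hi.injective hsp ha hX⟩
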